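/- **Conventions.** A Gauss word is a finite sequence of letters in which every letter that appears does so exactly twice; its rank is the number of distinct letters in it. Two Gauss words are isomorphic if a bijection between their sets of letters carries one to the other. Homotopy is the equivalence relation on Gauss words generated by isomorphisms and the moves (H1) $xAAy\leftrightarrow xy$, (H2) $xAByBAz\leftrightarrow xyz$, (H3) $xAByACzBCt\leftrightarrow xBAyCAzCBt$, where $x,y,z,t$ are arbitrary, possibly empty, words. Let $P$ be the set of homotopy classes of Gauss words and $\mathbb{Z}P$ the free abelian group on $P$. A Gauss word with semi-letters denotes the element of $\mathbb{Z}P$ given by expanding $x\dot Ay\dot Az = xAyAz - xyz$ for each semi-letter $\dot A$. Let $H$ be an abelian group. A homotopy invariant with values in $H$, extended linearly to a homomorphism $v:\mathbb{Z}P\to H$, has degree at most $n$ if $v(w)=0$ for every Gauss word $w$ with more than $n$ semi-letters; it is a finite type invariant if this holds for some $n$, and the least such $n$ is its degree. A finite type invariant $v:\mathbb{Z}P\to G$ of degree $n$ is universal of degree $n$ if for every abelian group $H$ and every finite type invariant $v':\mathbb{Z}P\to H$ of degree at most $n$ there is a homomorphism $f:G\to H$ with $v'=f\circ v$. For Gauss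 words $w,p$, let $\langle w,p\rangle$ be the number of subwords of $p$ (words obtained from $p$ by deleting all occurrences of the letters in some set of letters) that are isomorphic to $w$. **Statement.** Let $W_5$ be the set of the 148 Gauss words $w$ listed below, and let $v(w)\in(\mathbb{Z}/2)^6\oplus\mathbb{Z}/4$ be the vector that stands in front of $w$ (first six entries modulo 2, last entry modulo 4). Then there is a well-defined homomorphism $$\bar\Gamma_5:\mathbb{Z}P\to(\mathbb{Z}/2)^6\oplus\mathbb{Z}/4,\qquad \bar\Gamma_5(p)=\sum_{w\in W_5}\langle w,p\rangle\, v(w)\quad\text{for every Gauss word } p,$$ and $\bar\Gamma_5$ is the universal finite type invariant of degree 5, up to constants, in the following sense. 1. $\bar\Gamma_5$ is a finite type invariant of degree (exactly) 5, it vanishes on the empty word, and for every abelian group $H$ and every finite type invariant $v':\mathbb{Z}P\to H$ of degree at most 5 that vanishes on the empty word there is a homomorphism $f:(\mathbb{Z}/2)^6\oplus\mathbb{Z}/4\to H$ with $v'=f\circ\bar\Gamma_5$. 2. With the augmentation $\varepsilon:\mathbb{Z}P\to\mathbb{Z}$, $\sum a_iw_i\mapsto\sum a_i$, the map $(\varepsilon,\bar\Gamma_5):\mathbb{Z}P\to\mathbb{Z}\oplus(\mathbb{Z}/2)^6\oplus\mathbb{Z}/4$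 is a universal finite type invariant of degree 5. **The words $w\in W_5$ and their vectors $v(w)$.** - $(0,0,0,0,0,0,1)$: ABACDCBD, ABCBDACD, ABCDCADB. - $(0,0,0,0,0,0,2)$: ABACDECBDE, ABACDECBED, ABACDECDBE, ABACDEDCBE, ABCABDEDCE, ABCACDEBDE, ABCACDEBED, ABCADEBDEC, ABCADEBEDC, ABCADEDBCE, ABCADEDCBE, ABCBADEDCE, ABCBDEACDE, ABCBDEACED, ABCBDEADCE, ABCBDEDACE, ABCDABDECE, ABCDABECED, ABCDACDEBE, ABCDACEBED, ABCDADCEBE, ABCDADEBCE, ABCDADEBEC, ABCDADECBE, ABCDAEBCED, ABCDAEBECD, ABCDAEBEDC, ABCDAECBED, ABCDAECEBD, ABCDBADECE, ABCDBAECED, ABCDBCEADE, ABCDBEACDE, ABCDBEADCE, ABCDBECEAD, ABCDCBEADE, ABCDCEABDE, ABCDCEADBE, ABCDCEADEB, ABCDCEBADE, ABCDEBCEAD, ABCDEBDEAC, ABCDEBEACD, ABCDEBEADC, ABCDEBEDAC, ABCDECADEB, ABCDECAEDB, ABCDECBEAD, ABCDECDAEB, ABCDECEABD, ABCDECEBAD,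 ABCDEDABEC, ABCDEDAEBC, ABCDEDAECB, ABCDEDBAEC, ABCDEDCAEB. - $(0,0,0,0,0,1,2)$: ABCDEDBEAC. - $(0,0,0,0,1,0,2)$: ABCDECEADB. - $(0,0,0,1,0,0,0)$: ABCACDBEDE, ABCBDEAECD, ABCDCEAEDB, ABCDEDACEB. - $(0,0,0,1,0,1,2)$: ABCADCDEBE. - $(0,0,0,1,1,0,0)$: ABCADECDBE, ABCADEDBEC, ABCDBECADE. - $(0,0,0,1,1,0,2)$: ABCADBEDEC, ABCDCEDAEB. - $(0,0,0,1,1,1,0)$: ABACDBDECE, ABACDBECED, ABACDCEBED, ABACDEDBCE, ABCBDEDCAE, ABCDCAEDEB, ABCDCEBDAE. - $(0,0,1,0,0,0,0)$: ABCACDEDBE, ABCADBECDE, ABCDBEACED, ABCDECAEBD. - $(0,0,1,0,1,1,0)$: ABCBDAECED. - $(0,0,1,1,0,0,0)$: ABACDCBEDE, ABCBDACEDE, ABCBDADECE, ABCBDECEAD, ABCDADBECE, ABCDADECEB, ABCDAECEDB. - $(0,0,1,1,0,1,2)$: ABACDCEDBE. - $(0,0,1,1,1,0,0)$: ABCDACEDBE,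 ABCDAEBDEC, ABCDBDEACE. - $(0,0,1,1,1,0,2)$: ABCBDCEADE, ABCDBEDEAC. - $(0,0,1,1,1,1,0)$: ABACBDEDCE, ABCDCAEBED, ABCDCEBEAD, ABCDEBECAD. - $(0,1,0,0,0,0,0)$: ABCDBECAED, ABCDEACEBD, ABCDEADBEC. - $(0,1,0,0,0,0,2)$: ABCBDEDAEC. - $(0,1,0,0,1,0,0)$: ABCADEDCEB. - $(0,1,0,1,0,1,2)$: ABACDCEBDE, ABACDEDBEC, ABCADBDECE, ABCDBDAECE. - $(0,1,0,1,1,0,0)$: ABACDBCEDE, ABACDBEDEC, ABCBDCAEDE. - $(0,1,1,0,0,0,0)$: ABCDBEADEC, ABCDEBDACE, ABCDECADBE. - $(0,1,1,0,0,0,2)$: ABCDBDEAEC. - $(0,1,1,0,0,1,0)$: ABCDBDECAE. - $(0,1,1,1,0,0,2)$: ABCBDCEAED, ABCDCADEBE. - $(0,1,1,1,1,0,0)$: ABACBDCEDE, ABCADCEDEB, ABCADEBDCE, ABCBDCEDAE, ABCDACEBDE, ABCDAEDBEC, ABCDBEDACE, ABCDBEDAEC, ABCDEBDAEC, ABACBDCD.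 - $(0,1,1,1,1,0,3)$: ABCACDBD, ABCADBDC, ABCDBDAC. - $(0,1,1,1,1,1,2)$: ABACDECEBD, ABCBDAEDEC. - $(1,0,0,0,0,0,0)$: ABCADBECED, ABCADECEBD, ABCBDAECDE, ABCBDEDCEA, ABCDBDECEA, ABCDBECEDA, ABCDCAEDBE, ABCDCEBDEA, ABCDECEBDA, ABCDEDBECA. - $(1,0,0,0,1,1,2)$: ABCADCEBED, ABCADEBECD, ABCBDAEDCE, ABCDCAEBDE. -/

import Mathlib

/-!
Gauss words, their homotopy classes, semi-letters, finite type invariants, angle brackets.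
Letters are natural numbers; words are considered up to renaming of letters.
-/

universe u

namespace GaussWords

/-- A word over the alphabet `ℕ` is a Gauss word if every letter appearing in it appears exactly
twice. -/
def IsGauss (w : List ℕ) : Prop := ∀ a ∈ w, w.count a = 2

/-- Gauss words. -/
abbrev GaussWord : Type := {w : List ℕ // IsGauss w}

/-- Two words are isomorphic if a bijection between the sets of letters appearing in them
carries one to the other. -/
def WordIso (v w : List ℕ) : Prop :=
  ∃ f : ℕ → ℕ, Set.BijOn f {a | a ∈ v} {a | a ∈ w} ∧ v.map f = w

/-- Elementary steps: isomorphisms and the three homotopy moves. -/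
inductive Move : List ℕ → List ℕ → Prop
  | iso (v w : List ℕ) : WordIso v w → Move v w
  | H1 (x y : List ℕ) (A : ℕ) : Move (x ++ [A, A] ++ y) (x ++ y)
  | H2 (x y z : List ℕ) (A B : ℕ) :
      Move (x ++ [A, B] ++ y ++ [B, A] ++ z) (x ++ y ++ z)
  | H3 (x y z t : List ℕ) (A B C : ℕ) :
      Move (x ++ [A, B] ++ y ++ [A, C] ++ z ++ [B, C] ++ t)
        (x ++ [B, A] ++ y ++ [C, A] ++ z ++ [C, B] ++ t)

/-- Homotopy: the equivalence relation on Gauss words generated by isomorphisms and the moves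
between Gauss words. -/
def homotopy : Setoid GaussWord :=
  Relation.EqvGen.setoid (fun v w : GaussWord => Move v.1 w.1)

/-- The set `P` of homotopy classes of Gauss words. -/
abbrev HomotopyClass : Type := Quotient homotopy

/-- The free abelian group `ℤP` on the homotopy classes of Gauss words. -/
abbrev ZP : Type := FreeAbelianGroup HomotopyClass

/-- The generator of `ℤP` given by a Gauss word. -/
def cls (w : GaussWord) : ZP := FreeAbelianGroup.of (Quotient.mk homotopy w)

/-- The empty word. -/
def emptyWord : GaussWord := ⟨[], fun a ha => by simp at ha⟩

namespace GaussWord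

/-- The set of letters appearing in a Gauss word. -/
def letters (w : GaussWord) : Finset ℕ := w.1.toFinset

/-- The Gauss word obtained by deleting (both occurrences of) all the letters in `S`. -/
def delete (w : GaussWord) (S : Finset ℕ) : GaussWord :=
  ⟨w.1.filter (fun a => a ∉ S), fun a ha => by
    have h := List.mem_filter.1 ha
    exact (List.count_filter (p := fun a => decide (a ∉ S)) h.2).trans (w.2 a h.1)⟩

end GaussWord

/-- The element of `ℤP` given by the Gauss word `w` in which the letters in `S` are turned into
semi-letters: the full expansion of `x Ȧ y Ȧ z = xAyAz - xyz` for all letters `A` in `S`. -/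
def semiWord (w : GaussWord) (S : Finset ℕ) : ZP :=
  ∑ T ∈ S.powerset, (-1 : ℤ) ^ T.card • cls (w.delete T)

/-- Without semi-letters one has the word itself. -/
theorem semiWord_empty (w : GaussWord) : semiWord w ∅ = cls w := by
  have : w.delete ∅ = w := Subtype.ext (by simp [GaussWord.delete])
  simp [semiWord, this]

/-- The defining relation of a semi-letter `A`. -/
theorem semiWord_insert (w : GaussWord) (S : Finset ℕ) (A : ℕ) (hA : A ∉ S) :
    semiWord w (insert A S) = semiWord w S - semiWord (w.delete {A}) S := by
  unfold semiWord
  rw [Finset.sum_powerset_insert hA, sub_eq_add_neg, ← Finset.sum_neg_distrib]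
  congr 1
  refine Finset.sum_congr rfl fun T hT => ?_
  have hAT : A ∉ T := fun h => hA (Finset.mem_powerset.1 hT h)
  have hd : w.delete (insert A T) = (w.delete {A}).delete T := by
    refine Subtype.ext ?_
    simp only [GaussWord.delete, List.filter_filter]
    refine List.filter_congr fun a _ => ?_
    simp [Finset.mem_insert, not_or, Bool.and_comm]
  rw [Finset.card_insert_of_notMem hAT, hd, pow_succ]
  simp

/-- A homotopy invariant with values in an abelian group, extended linearly to `ℤP`, is of degree
at most `n` if it vanishes on every Gauss word with more than `n` semi-letters. It is a finite
type invariant if this holds for some `n`. -/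
def HasDegreeLE {G : Type*} [AddCommGroup G] (v : ZP →+ G) (n : ℕ) : Prop :=
  ∀ (w : GaussWord) (S : Finset ℕ), S ⊆ w.letters → n < S.card → v (semiWord w S) = 0

/-- `v` is a finite type invariant of degree `n`: the least integer bounding its degree is `n`. -/
def HasDegree {G : Type*} [AddCommGroup G] (v : ZP →+ G) (n : ℕ) : Prop :=
  IsLeast {m | HasDegreeLE v m} n

/-- `v` is a universal finite type invariant of degree `n`: it has degree `n` and every finite type
invariant of degree at most `n` is the composite of `v` and a homomorphism. -/
def IsUniversal.{g, h} {G : Type g} [AddCommGroup G] (v : ZP →+ G) (n : ℕ) : Prop :=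
  HasDegree v n ∧
    ∀ (H : Type h) [AddCommGroup H] (v' : ZP →+ H), HasDegreeLE v' n →
      ∃ f : G →+ H, v' = f.comp v

/-- As `IsUniversal`, among the invariants which are normalized to vanish on the empty word. -/
def IsReducedUniversal.{g, h} {G : Type g} [AddCommGroup G] (v : ZP →+ G) (n : ℕ) : Prop :=
  HasDegree v n ∧ v (cls emptyWord) = 0 ∧
    ∀ (H : Type h) [AddCommGroup H] (v' : ZP →+ H), HasDegreeLE v' n → v' (cls emptyWord) = 0 →
      ∃ f : G →+ H, v' = f.comp v

/-- The homomorphism `∑ aᵢ wᵢ ↦ ∑ aᵢ`. -/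
def augmentation : ZP →+ ℤ := FreeAbelianGroup.lift fun _ => 1

open Classical in
/-- The angle bracket `⟨w, p⟩`: the number of subwords of `p` isomorphic to `w`. A subword is
obtained by deleting letters, so it is given by the set of the letters that are kept. -/
noncomputable def bracket (w : List ℕ) (p : GaussWord) : ℕ :=
  (p.letters.powerset.filter fun S => WordIso w (p.1.filter fun a => a ∈ S)).card

/-- The group `(ℤ/2)⁶ ⊕ ℤ/4`. -/
abbrev Target : Type := (Fin 6 → ZMod 2) × ZMod 4

namespace Letter

abbrev A : ℕ := 0
abbrev B : ℕ := 1
abbrev C : ℕ := 2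
abbrev D : ℕ := 3
abbrev E : ℕ := 4

end Letter

open Letter in
/-- The table of the words in `W₅`: each row has a vector, followed by the words `w` for which
`v(w)` is this vector. -/
def table : List (Target × List (List ℕ)) :=
  [((![0,0,0,0,0,0], 1),
     [[A,B,A,C,D,C,B,D],
      [A,B,C,B,D,A,C,D],
      [A,B,C,D,C,A,D,B]]),
   ((![0,0,0,0,0,0], 2),
     [[A,B,A,C,D,E,C,B,D,E],
      [A,B,A,C,D,E,C,B,E,D],
      [A,B,A,C,D,E,C,D,B,E],
      [A,B,A,C,D,E,D,C,B,E],
      [A,B,C,A,B,D,E,D,C,E],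
      [A,B,C,A,C,D,E,B,D,E],
      [A,B,C,A,C,D,E,B,E,D],
      [A,B,C,A,D,E,B,D,E,C],
      [A,B,C,A,D,E,B,E,D,C],
      [A,B,C,A,D,E,D,B,C,E],
      [A,B,C,A,D,E,D,C,B,E],
      [A,B,C,B,A,D,E,D,C,E],
      [A,B,C,B,D,E,A,C,D,E],
      [A,B,C,B,D,E,A,C,E,D],
      [A,B,C,B,D,E,A,D,C,E],
      [A,B,C,B,D,E,D,A,C,E],
      [A,B,C,D,A,B,D,E,C,E],
      [A,B,C,D,A,B,E,C,E,D],
      [A,B,C,D,A,C,D,E,B,E],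
      [A,B,C,D,A,C,E,B,E,D],
      [A,B,C,D,A,D,C,E,B,E],
      [A,B,C,D,A,D,E,B,C,E],
      [A,B,C,D,A,D,E,B,E,C],
      [A,B,C,D,A,D,E,C,B,E],
      [A,B,C,D,A,E,B,C,E,D],
      [A,B,C,D,A,E,B,E,C,D],
      [A,B,C,D,A,E,B,E,D,C],
      [A,B,C,D,A,E,C,B,E,D],
      [A,B,C,D,A,E,C,E,B,D],
      [A,B,C,D,B,A,D,E,C,E],
      [A,B,C,D,B,A,E,C,E,D],
      [A,B,C,D,B,C,E,A,D,E],
      [A,B,C,D,B,E,A,C,D,E],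
      [A,B,C,D,B,E,A,D,C,E],
      [A,B,C,D,B,E,C,E,A,D],
      [A,B,C,D,C,B,E,A,D,E],
      [A,B,C,D,C,E,A,B,D,E],
      [A,B,C,D,C,E,A,D,B,E],
      [A,B,C,D,C,E,A,D,E,B],
      [A,B,C,D,C,E,B,A,D,E],
      [A,B,C,D,E,B,C,E,A,D],
      [A,B,C,D,E,B,D,E,A,C],
      [A,B,C,D,E,B,E,A,C,D],
      [A,B,C,D,E,B,E,A,D,C],
      [A,B,C,D,E,B,E,D,A,C],
      [A,B,C,D,E,C,A,D,E,B],
      [A,B,C,D,E,C,A,E,D,B],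
      [A,B,C,D,E,C,B,E,A,D],
      [A,B,C,D,E,C,D,A,E,B],
      [A,B,C,D,E,C,E,A,B,D],
      [A,B,C,D,E,C,E,B,A,D],
      [A,B,C,D,E,D,A,B,E,C],
      [A,B,C,D,E,D,A,E,B,C],
      [A,B,C,D,E,D,A,E,C,B],
      [A,B,C,D,E,D,B,A,E,C],
      [A,B,C,D,E,D,C,A,E,B]]),
   ((![0,0,0,0,0,1], 2),
     [[A,B,C,D,E,D,B,E,A,C]]),
   ((![0,0,0,0,1,0], 2),
     [[A,B,C,D,E,C,E,A,D,B]]),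
   ((![0,0,0,1,0,0], 0),
     [[A,B,C,A,C,D,B,E,D,E],
      [A,B,C,B,D,E,A,E,C,D],
      [A,B,C,D,C,E,A,E,D,B],
      [A,B,C,D,E,D,A,C,E,B]]),
   ((![0,0,0,1,0,1], 2),
     [[A,B,C,A,D,C,D,E,B,E]]),
   ((![0,0,0,1,1,0], 0),
     [[A,B,C,A,D,E,C,D,B,E],
      [A,B,C,A,D,E,D,B,E,C],
      [A,B,C,D,B,E,C,A,D,E]]),
   ((![0,0,0,1,1,0], 2),
     [[A,B,C,A,D,B,E,D,E,C],
      [A,B,C,D,C,E,D,A,E,B]]),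
   ((![0,0,0,1,1,1], 0),
     [[A,B,A,C,D,B,D,E,C,E],
      [A,B,A,C,D,B,E,C,E,D],
      [A,B,A,C,D,C,E,B,E,D],
      [A,B,A,C,D,E,D,B,C,E],
      [A,B,C,B,D,E,D,C,A,E],
      [A,B,C,D,C,A,E,D,E,B],
      [A,B,C,D,C,E,B,D,A,E]]),
   ((![0,0,1,0,0,0], 0),
     [[A,B,C,A,C,D,E,D,B,E],
      [A,B,C,A,D,B,E,C,D,E],
      [A,B,C,D,B,E,A,C,E,D],
      [A,B,C,D,E,C,A,E,B,D]]),
   ((![0,0,1,0,1,1], 0),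
     [[A,B,C,B,D,A,E,C,E,D]]),
   ((![0,0,1,1,0,0], 0),
     [[A,B,A,C,D,C,B,E,D,E],
      [A,B,C,B,D,A,C,E,D,E],
      [A,B,C,B,D,A,D,E,C,E],
      [A,B,C,B,D,E,C,E,A,D],
      [A,B,C,D,A,D,B,E,C,E],
      [A,B,C,D,A,D,E,C,E,B],
      [A,B,C,D,A,E,C,E,D,B]]),
   ((![0,0,1,1,0,1], 2),
     [[A,B,A,C,D,C,E,D,B,E]]),
   ((![0,0,1,1,1,0], 0),
     [[A,B,C,D,A,C,E,D,B,E],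
      [A,B,C,D,A,E,B,D,E,C],
      [A,B,C,D,B,D,E,A,C,E]]),
   ((![0,0,1,1,1,0], 2),
     [[A,B,C,B,D,C,E,A,D,E],
      [A,B,C,D,B,E,D,E,A,C]]),
   ((![0,0,1,1,1,1], 0),
     [[A,B,A,C,B,D,E,D,C,E],
      [A,B,C,D,C,A,E,B,E,D],
      [A,B,C,D,C,E,B,E,A,D],
      [A,B,C,D,E,B,E,C,A,D]]),
   ((![0,1,0,0,0,0], 0),
     [[A,B,C,D,B,E,C,A,E,D],
      [A,B,C,D,E,A,C,E,B,D],
      [A,B,C,D,E,A,D,B,E,C]]),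
   ((![0,1,0,0,0,0], 2),
     [[A,B,C,B,D,E,D,A,E,C]]),
   ((![0,1,0,0,1,0], 0),
     [[A,B,C,A,D,E,D,C,E,B]]),
   ((![0,1,0,1,0,1], 2),
     [[A,B,A,C,D,C,E,B,D,E],
      [A,B,A,C,D,E,D,B,E,C],
      [A,B,C,A,D,B,D,E,C,E],
      [A,B,C,D,B,D,A,E,C,E]]),
   ((![0,1,0,1,1,0], 0),
     [[A,B,A,C,D,B,C,E,D,E],
      [A,B,A,C,D,B,E,D,E,C],
      [A,B,C,B,D,C,A,E,D,E]]),
   ((![0,1,1,0,0,0], 0),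
     [[A,B,C,D,B,E,A,D,E,C],
      [A,B,C,D,E,B,D,A,C,E],
      [A,B,C,D,E,C,A,D,B,E]]),
   ((![0,1,1,0,0,0], 2),
     [[A,B,C,D,B,D,E,A,E,C]]),
   ((![0,1,1,0,0,1], 0),
     [[A,B,C,D,B,D,E,C,A,E]]),
   ((![0,1,1,1,0,0], 2),
     [[A,B,C,B,D,C,E,A,E,D],
      [A,B,C,D,C,A,D,E,B,E]]),
   ((![0,1,1,1,1,0], 0),
     [[A,B,A,C,B,D,C,E,D,E],
      [A,B,C,A,D,C,E,D,E,B],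
      [A,B,C,A,D,E,B,D,C,E],
      [A,B,C,B,D,C,E,D,A,E],
      [A,B,C,D,A,C,E,B,D,E],
      [A,B,C,D,A,E,D,B,E,C],
      [A,B,C,D,B,E,D,A,C,E],
      [A,B,C,D,B,E,D,A,E,C],
      [A,B,C,D,E,B,D,A,E,C],
      [A,B,A,C,B,D,C,D]]),
   ((![0,1,1,1,1,0], 3),
     [[A,B,C,A,C,D,B,D],
      [A,B,C,A,D,B,D,C],
      [A,B,C,D,B,D,A,C]]),
   ((![0,1,1,1,1,1], 2),
     [[A,B,A,C,D,E,C,E,B,D],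
      [A,B,C,B,D,A,E,D,E,C]]),
   ((![1,0,0,0,0,0], 0),
     [[A,B,C,A,D,B,E,C,E,D],
      [A,B,C,A,D,E,C,E,B,D],
      [A,B,C,B,D,A,E,C,D,E],
      [A,B,C,B,D,E,D,C,E,A],
      [A,B,C,D,B,D,E,C,E,A],
      [A,B,C,D,B,E,C,E,D,A],
      [A,B,C,D,C,A,E,D,B,E],
      [A,B,C,D,C,E,B,D,E,A],
      [A,B,C,D,E,C,E,B,D,A],
      [A,B,C,D,E,D,B,E,C,A]]),
   ((![1,0,0,0,1,1], 2),
     [[A,B,C,A,D,C,E,B,E,D],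
      [A,B,C,A,D,E,B,E,C,D],
      [A,B,C,B,D,A,E,D,C,E],
      [A,B,C,D,C,A,E,B,D,E]])]

/-- The pairs `(w, v(w))` for the words `w` in `W₅`. -/
def wordVectors : List (List ℕ × Target) :=
  table.flatMap fun row => row.2.map fun w => (w, row.1)

/-- The sum of `⟨w, p⟩ v(w)` over the words `w` in `W₅`. -/
noncomputable def gammaBar5 (p : GaussWord) : Target :=
  (wordVectors.map fun e => bracket e.1 p • e.2).sum

end GaussWords

/-! Let `v` be an invariant of degree at most 5 that vanishes on the empty word. Its symbol sends a
Gauss word `w` to the value of `v` on `w` with every letter a semi-letter. By Möbius inversion over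
sets of letters, `v` at `p` is the sum of its symbol over all subwords of `p`. Under this
correspondence the homotopy moves become the linear relations of a Polyak algebra, and the degree
bound becomes vanishing in rank above 5. Functions of this kind are the weight systems (`IsWeight`);
the two directions are `IsWeight.invariant` and `isWeight_symbol`. The theorem thus amounts to
finding a universal weight system.

That the table is a weight system is a finite check on representatives of isomorphism classes, with
words and vectors encoded as numbers (`isWeight_tableWeight`).

For universality, doubling a letter in the second relation expresses twice a value as minus a value
one rank higher. Hence `2 ^ k` kills the values in rank above `5 - k` (`IsWeight.two_pow_smul`), and
the values generate a group `D` of bounded 2-power exponent. Modulo 2 signs disappear, words with a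
bigon vanish, and the third relation eliminates all but seven words
(`IsWeight.eq_zero_of_basisWords`). As in Nakayama's lemma, a weight system vanishing on these seven
words has `D = 2D`, hence `D = 0` (`eq_zero_of_symbol_basisWords`).

Six of the seven words have rank 5, with values killed by 2; the last has rank 4, with value killed
by 4. Their table values form a basis of `(ℤ/2)⁶ ⊕ ℤ/4`, so a homomorphism `f` with the prescribed
values exists (`exists_hom_basisWords`). Then `v` minus the composite of `f` with the table
invariant has a symbol vanishing on the seven words, so it is zero. Constants are split off by the
augmentation. -/

namespace GaussWords

/-! ### Patterns of words -/

/-- The word with each letter replaced by the position of its first occurrence. -/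
def pattern (w : List ℕ) : List ℕ := w.map fun a => w.idxOf a

theorem idxOf_map_of_injOn {f : ℕ → ℕ} {a : ℕ} :
    ∀ {v : List ℕ}, Set.InjOn f {b | b ∈ a :: v} → (v.map f).idxOf (f a) = v.idxOf a
  | [], _ => rfl
  | b :: v, h => by
    have ih : (v.map f).idxOf (f a) = v.idxOf a :=
      idxOf_map_of_injOn (h.mono fun c hc => by
        simp only [Set.mem_ofPred_eq, List.mem_cons] at hc ⊢; tauto)
    by_cases hab : b = a
    · simp [hab]
    · have : f b ≠ f a := fun e => hab (h (by simp) (by simp) e)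
      simp [hab, this, ih]

theorem wordIso_map {f : ℕ → ℕ} {v : List ℕ} (h : Set.InjOn f {a | a ∈ v}) :
    WordIso v (v.map f) := by
  refine ⟨f, ⟨fun a ha => ?_, h, fun b hb => ?_⟩, rfl⟩
  · exact List.mem_map_of_mem ha
  · obtain ⟨a, ha, rfl⟩ := List.mem_map.1 hb
    exact ⟨a, ha, rfl⟩

theorem WordIso.length_eq {v w : List ℕ} (h : WordIso v w) : v.length = w.length := by
  obtain ⟨f, -, rfl⟩ := h; simp

theorem WordIso.isGauss {v w : List ℕ} (h : WordIso v w) (hv : IsGauss v) : IsGauss w := by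
  obtain ⟨f, hf, rfl⟩ := h
  intro b hb
  obtain ⟨a, ha, rfl⟩ := List.mem_map.1 hb
  rw [← hv a ha, List.count_eq_countP, List.count_eq_countP, List.countP_map]
  refine List.countP_congr fun c hc => ?_
  simp only [Function.comp, beq_iff_eq]
  exact ⟨fun e => hf.injOn hc ha e, fun e => e ▸ rfl⟩

theorem WordIso.pattern_eq {v w : List ℕ} (h : WordIso v w) : pattern v = pattern w := by
  obtain ⟨f, hf, rfl⟩ := h
  simp only [pattern, List.map_map]
  refine List.map_congr_left fun a ha => ?_
  refine (idxOf_map_of_injOn (hf.injOn.mono fun c hc => ?_)).symm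
  simp only [Set.mem_ofPred_eq, List.mem_cons] at hc ⊢
  rcases hc with rfl | hc <;> assumption

/-- Position by position, both words refer back to the same first occurrence. Matching letters
through their first positions is therefore well defined and injective. -/
theorem wordIso_of_pattern_eq {v w : List ℕ} (h : pattern v = pattern w) : WordIso v w := by
  have hl : v.length = w.length := by simpa [pattern] using congrArg List.length h
  have hi : ∀ (i : ℕ) (hv : i < v.length) (hw : i < w.length), v.idxOf v[i] = w.idxOf w[i] := by
    intro i hv hw
    have := List.getElem_of_eq h (i := i) (by simpa [pattern] using hv)
    simpa [pattern] using this
  -- The default 0 is reached only outside the letters of `v`.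
  let f : ℕ → ℕ := fun a => w.getD (v.idxOf a) 0
  have hf : ∀ (i : ℕ) (hv : i < v.length) (hw : i < w.length), f v[i] = w[i] := by
    intro i hv hw
    have hlt : w.idxOf w[i] < w.length := List.idxOf_lt_length_of_mem (List.getElem_mem hw)
    simp only [f, hi i hv hw]
    rw [List.getD_eq_getElem _ _ hlt, List.getElem_idxOf]
  have hmap : v.map f = w := by
    refine List.ext_getElem (by simpa using hl) fun i h₁ h₂ => ?_
    rw [List.getElem_map]
    exact hf i (by simpa using h₁) h₂
  have hinj : Set.InjOn f {a | a ∈ v} := by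
    intro a ha b hb hab
    obtain ⟨i, hiv, rfl⟩ := List.getElem_of_mem ha
    obtain ⟨j, hjv, rfl⟩ := List.getElem_of_mem hb
    rw [hf i hiv (hl ▸ hiv), hf j hjv (hl ▸ hjv)] at hab
    have e : v.idxOf v[i] = v.idxOf v[j] := by
      rw [hi i hiv (hl ▸ hiv), hi j hjv (hl ▸ hjv), hab]
    exact (List.idxOf_inj ha).1 e
  simpa [hmap] using wordIso_map hinj

theorem wordIso_iff_pattern_eq {v w : List ℕ} : WordIso v w ↔ pattern v = pattern w :=
  ⟨WordIso.pattern_eq, wordIso_of_pattern_eq⟩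

theorem WordIso.symm {v w : List ℕ} (h : WordIso v w) : WordIso w v :=
  wordIso_of_pattern_eq h.pattern_eq.symm

/-! ### Numerical codes -/

/-- The position of the first occurrence of `a`, in a form suited to evaluation by the kernel. -/
def firstIdx (a : ℕ) : List ℕ → ℕ
  | [] => 0
  | b :: l => bif Nat.beq b a then 0 else firstIdx a l + 1

theorem firstIdx_eq_idxOf (a : ℕ) (l : List ℕ) : firstIdx a l = l.idxOf a := by
  induction l with
  | nil => rfl
  | cons b l ih =>
    by_cases h : b = a
    · simp [firstIdx, h]
    · have : Nat.beq b a = false := Bool.eq_false_iff.2 fun e => h (Nat.eq_of_beq_eq_true e)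
      simp [firstIdx, this, h, ih]

/-- A list of digits as a number in base 16. -/
def pack : List ℕ → ℕ
  | [] => 0
  | a :: l => a + 1 + 16 * pack l

/-- The shift by one in `pack` leaves no zero digit, so the length is recovered as well; `a < 15`
makes the shifted digits fit base 16. -/
theorem pack_injOn : ∀ {v w : List ℕ}, (∀ a ∈ v, a < 15) → (∀ a ∈ w, a < 15) →
    pack v = pack w → v = w
  | [], [], _, _, _ => rfl
  | [], b :: w, _, _, h => by simp only [pack] at h; omega
  | a :: v, [], _, _, h => by simp only [pack] at h; omega
  | a :: v, b :: w, hv, hw, h => by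
    have ha := hv a (by simp)
    have hb := hw b (by simp)
    simp only [pack] at h
    have e : a = b := by omega
    have e' : v = w := pack_injOn (fun c hc => hv c (by simp [hc])) (fun c hc => hw c (by simp [hc]))
      (by omega)
    rw [e, e']

/-- A number that determines the isomorphism class of a word of length at most 15. -/
def code (w : List ℕ) : ℕ := pack (w.map fun a => firstIdx a w)

theorem code_eq_pack_pattern (w : List ℕ) : code w = pack (pattern w) := by
  simp [code, pattern, firstIdx_eq_idxOf]

theorem WordIso.code_eq {v w : List ℕ} (h : WordIso v w) : code v = code w := by
  rw [code_eq_pack_pattern, code_eq_pack_pattern, h.pattern_eq]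

theorem wordIso_of_code_eq {v w : List ℕ} (hv : v.length ≤ 15) (hw : w.length ≤ 15)
    (h : code v = code w) : WordIso v w := by
  rw [code_eq_pack_pattern, code_eq_pack_pattern] at h
  have key : ∀ u : List ℕ, u.length ≤ 15 → ∀ a ∈ pattern u, a < 15 := by
    intro u hu a ha
    obtain ⟨b, hb, rfl⟩ := List.mem_map.1 ha
    exact (List.idxOf_lt_length_of_mem hb).trans_le hu
  exact wordIso_of_pattern_eq (pack_injOn (key v hv) (key w hw) h)

/-! ### Scanning a word in pieces -/

/-- Reads a word letter by letter. The state consists of the table `e` of the first occurrences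
so far, in base 16, of the number `n` of letters read so far, and of the code `c` so far. -/
noncomputable def scan (l : List ℕ) : (ℕ → ℕ → ℕ → ℕ) → ℕ → ℕ → ℕ → ℕ :=
  List.rec (motive := fun _ => (ℕ → ℕ → ℕ → ℕ) → ℕ → ℕ → ℕ → ℕ) (fun k => k)
    (fun a _ ih k e n c =>
      (fun d => cond (Nat.beq d 0)
        (ih k (Nat.add e (Nat.mul (Nat.succ n) (Nat.pow 16 a))) (Nat.succ n)
          (Nat.add c (Nat.mul (Nat.succ n) (Nat.pow 16 n))))
        (ih k e (Nat.succ n) (Nat.add c (Nat.mul d (Nat.pow 16 n)))))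
      (Nat.mod (Nat.div e (Nat.pow 16 a)) 16)) l

/-- The code of a word that is given in pieces. -/
noncomputable def scanCode (ps : List (List ℕ)) : ℕ :=
  List.rec (motive := fun _ => ℕ → ℕ → ℕ → ℕ) (fun _ _ c => c) (fun p _ ih => scan p ih) ps 0 0 0

theorem scan_append (l m : List ℕ) (k : ℕ → ℕ → ℕ → ℕ) (e n c : ℕ) :
    scan (l ++ m) k e n c = scan l (scan m k) e n c := by
  induction l generalizing e n c with
  | nil => rfl
  | cons a l ih =>
    change cond _ (scan (l ++ m) k _ _ _) (scan (l ++ m) k _ _ _)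
      = cond _ (scan l (scan m k) _ _ _) (scan l (scan m k) _ _ _)
    rw [ih, ih]

theorem scanCode_eq_scan_flatten (ps : List (List ℕ)) :
    scanCode ps = scan ps.flatten (fun _ _ c => c) 0 0 0 := by
  have h : ∀ ps : List (List ℕ), (List.rec (motive := fun _ => ℕ → ℕ → ℕ → ℕ) (fun _ _ c => c)
      (fun p _ ih => scan p ih) ps : ℕ → ℕ → ℕ → ℕ) = scan ps.flatten fun _ _ c => c := by
    intro ps
    induction ps with
    | nil => rfl
    | cons p ps ih =>
      funext e n c
      rw [List.flatten_cons, scan_append, ← ih]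
  exact congrFun (congrFun (congrFun (h ps) 0) 0) 0

/-- The digit of `e` at place `a` in base 16. -/
def digit (e a : ℕ) : ℕ := e / 16 ^ a % 16

theorem digit_add_self {e a m : ℕ} (h : digit e a = 0) (hm : m < 16) :
    digit (e + m * 16 ^ a) a = m := by
  unfold digit at h ⊢
  rw [Nat.add_mul_div_right _ _ (by positivity)]
  omega

/-- The place `a` is vacant and `m` is a single digit, so no carry occurs. -/
theorem digit_add_of_ne {e a b m : ℕ} (h : digit e a = 0) (hm : m < 16) (hab : a ≠ b) :
    digit (e + m * 16 ^ a) b = digit e b := by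
  unfold digit at h ⊢
  rcases lt_or_gt_of_ne hab with hlt | hlt
  · obtain ⟨d, rfl⟩ : ∃ d, b = a + 1 + d := ⟨b - (a + 1), by omega⟩
    have h₁ : (e + m * 16 ^ a) / 16 ^ (a + 1) = e / 16 ^ (a + 1) := by
      rw [pow_succ, ← Nat.div_div_eq_div_mul, ← Nat.div_div_eq_div_mul,
        Nat.add_mul_div_right _ _ (by positivity)]
      omega
    rw [pow_add, ← Nat.div_div_eq_div_mul, ← Nat.div_div_eq_div_mul, h₁]
  · obtain ⟨d, rfl⟩ : ∃ d, a = b + 1 + d := ⟨a - (b + 1), by omega⟩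
    have : e + m * 16 ^ (b + 1 + d) = e + (16 * (m * 16 ^ d)) * 16 ^ b := by ring
    rw [this, Nat.add_mul_div_right _ _ (by positivity), Nat.add_mul_mod_self_left]

theorem pack_append (l m : List ℕ) : pack (l ++ m) = pack l + pack m * 16 ^ l.length := by
  induction l with
  | nil => simp [pack]
  | cons a l ih => simp only [List.cons_append, pack, ih, List.length_cons, pow_succ]; ring

/-- This is the loop invariant: after reading `p`, the digit of `e` at place `a` is one more than
the first position of `a` in `p`, and the digit 0 means that `a` has not occurred. -/
theorem scan_eq_code (l : List ℕ) : ∀ (p : List ℕ) (e : ℕ), (∀ a ∈ l, a < 16) →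
    (p ++ l).length ≤ 15 →
    (∀ a, digit e a = if a ∈ p then p.idxOf a + 1 else 0) →
    scan l (fun _ _ c => c) e p.length (pack (pattern p)) = pack (pattern (p ++ l)) := by
  induction l with
  | nil => intro p e _ _ _; simp [scan]
  | cons a l ih =>
    intro p e ha hl he
    have hlen : p.length + 1 ≤ 15 := by simp at hl; omega
    have hscan : ∀ c, scan (a :: l) (fun _ _ c => c) e p.length c =
      cond (Nat.beq (digit e a) 0)
        (scan l (fun _ _ c => c) (e + (p.length + 1) * 16 ^ a) (p.length + 1)
          (c + (p.length + 1) * 16 ^ p.length))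
        (scan l (fun _ _ c => c) e (p.length + 1) (c + digit e a * 16 ^ p.length)) := fun _ => rfl
    have hpat : pattern (p ++ [a]) = pattern p ++ [(p ++ [a]).idxOf a] := by
      simp only [pattern, List.map_append, List.map_cons, List.map_nil]
      congr 1
      exact List.map_congr_left fun b hb => List.idxOf_append_of_mem hb
    have hpl : (pattern p).length = p.length := by simp [pattern]
    have ih' := fun e' => ih (p ++ [a]) e' (fun b hb => ha b (by simp [hb])) (by simpa using hl)
    simp only [List.length_append, List.length_cons, List.length_nil, zero_add,
      List.append_assoc, List.cons_append, List.nil_append] at ih'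
    rw [hscan]
    by_cases hap : a ∈ p
    · have hd : digit e a = p.idxOf a + 1 := by rw [he, if_pos hap]
      have hb : Nat.beq (digit e a) 0 = false := by rw [hd]; rfl
      rw [hb, cond_false, ← ih' e, hpat, pack_append, hpl, List.idxOf_append_of_mem hap, hd]
      · simp [pack]
      · intro b
        rw [he b]
        by_cases hbp : b ∈ p
        · simp [hbp, List.idxOf_append_of_mem hbp]
        · have : b ≠ a := fun h => hbp (h ▸ hap)
          simp [hbp, this]
    · have hd : digit e a = 0 := by rw [he, if_neg hap]
      have hb : Nat.beq (digit e a) 0 = true := by rw [hd]; rfl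
      have hidx : (p ++ [a]).idxOf a = p.length := by
        rw [List.idxOf_append_of_notMem hap]; simp
      rw [hb, cond_true, ← ih' (e + (p.length + 1) * 16 ^ a), hpat, pack_append, hpl, hidx]
      · simp [pack]
      · intro b
        by_cases hba : b = a
        · subst hba
          rw [digit_add_self hd (by omega), hidx]
          simp
        · rw [digit_add_of_ne hd (by omega) (Ne.symm hba), he b]
          by_cases hbp : b ∈ p
          · simp [hbp, List.idxOf_append_of_mem hbp]
          · simp [hbp, hba]

theorem scanCode_eq_code (ps : List (List ℕ)) (h : ∀ a ∈ ps.flatten, a < 16)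
    (hl : ps.flatten.length ≤ 15) : scanCode ps = code ps.flatten := by
  rw [scanCode_eq_scan_flatten, code_eq_pack_pattern]
  exact scan_eq_code ps.flatten [] 0 h (by simpa using hl) (by simp [digit])

/-! ### Enumeration of Gauss words -/

/-- Checks a property of all the ways to cut a list into two. -/
def allSplits : List ℕ → (List ℕ → List ℕ → Bool) → Bool
  | [], P => P [] []
  | a :: l, P => P [] (a :: l) && allSplits l fun x y => P (a :: x) y

theorem of_allSplits {l : List ℕ} {P : List ℕ → List ℕ → Bool} (h : allSplits l P = true)
    (x y : List ℕ) (hl : x ++ y = l) : P x y = true := by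
  induction l generalizing P x with
  | nil =>
    obtain ⟨rfl, rfl⟩ := List.append_eq_nil_iff.1 hl
    exact h
  | cons a l ih =>
    simp only [allSplits, Bool.and_eq_true] at h
    cases x with
    | nil => rw [List.nil_append] at hl; rw [hl]; exact h.1
    | cons b x =>
      obtain ⟨rfl, hxy⟩ := List.cons.inj hl
      exact ih h.2 x hxy

/-- Checks a property of representatives of all the isomorphism classes of Gauss words of a given
rank. -/
def allGauss : ℕ → (List ℕ → Bool) → Bool
  | 0, P => P []
  | n + 1, P => allGauss n fun u => allSplits u fun x y => P (n :: (x ++ n :: y))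

theorem IsGauss.of_perm {v w : List ℕ} (hv : IsGauss v) (h : v.Perm w) : IsGauss w :=
  fun a ha => (h.count_eq a).symm.trans (hv a (h.mem_iff.2 ha))

theorem IsGauss.of_cons_cons {a : ℕ} {w : List ℕ} (h : IsGauss (a :: a :: w)) :
    a ∉ w ∧ IsGauss w := by
  have ha : a ∉ w := by
    have := h a (by simp)
    simp only [List.count_cons_self] at this
    exact List.count_eq_zero.1 (by omega)
  refine ⟨ha, fun b hb => ?_⟩
  have hne : a ≠ b := fun e => ha (e ▸ hb)
  simpa [List.count_cons, hne] using h b (by simp [hb])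

theorem IsGauss.cons_cons {a : ℕ} {w : List ℕ} (h : IsGauss w) (ha : a ∉ w) :
    IsGauss (a :: a :: w) := by
  intro b hb
  by_cases hab : a = b
  · subst hab
    simp [List.count_eq_zero.2 ha]
  · have : b ∈ w := by
      simp only [List.mem_cons] at hb
      rcases hb with h | h | h
      · exact absurd h.symm hab
      · exact absurd h.symm hab
      · exact h
    simpa [List.count_cons, hab] using h b this

theorem IsGauss.length_eq {w : List ℕ} (h : IsGauss w) : w.length = 2 * w.toFinset.card := by
  rw [← List.sum_toFinset_count_eq_length,
    Finset.sum_congr rfl fun a ha => h a (List.mem_toFinset.1 ha)]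
  simp [mul_comm]

theorem IsGauss.exists_length_eq {w : List ℕ} (h : IsGauss w) : ∃ r, w.length = 2 * r :=
  ⟨_, h.length_eq⟩

theorem IsGauss.exists_of_cons {a : ℕ} {v : List ℕ} (h : IsGauss (a :: v)) :
    ∃ x y, v = x ++ a :: y ∧ a ∉ x ++ y ∧ IsGauss (x ++ y) := by
  have hav : a ∈ v := by
    have := h a (by simp)
    rw [List.count_cons_self] at this
    exact List.count_pos_iff.1 (by omega)
  obtain ⟨x, y, rfl⟩ := List.append_of_mem hav
  have hp : (a :: (x ++ a :: y)).Perm (a :: a :: (x ++ y)) := List.Perm.cons _ List.perm_middle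
  exact ⟨x, y, rfl, (h.of_perm hp).of_cons_cons⟩

/-- The first letter of a Gauss word occurs once more, and deleting both occurrences lowers the rank
by one. The deleted letter is matched with `n`, which exceeds all letters of the smaller
representative. -/
theorem of_allGauss {n : ℕ} {P : List ℕ → Bool} (h : allGauss n P = true) (w : List ℕ)
    (hw : IsGauss w) (hn : w.length = 2 * n) :
    ∃ (u : List ℕ) (f : ℕ → ℕ), u.map f = w ∧ Set.InjOn f {a | a ∈ u} ∧ (∀ a ∈ u, a < n) ∧
      P u = true := by
  induction n generalizing P w with
  | zero =>
    obtain rfl := List.length_eq_zero_iff.1 (hn.trans (mul_zero 2))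
    exact ⟨[], id, rfl, Set.injOn_id _, by simp, h⟩
  | succ n ih =>
    cases w with
    | nil => simp at hn
    | cons a v =>
      obtain ⟨x, y, rfl, ha, hxy⟩ := hw.exists_of_cons
      obtain ⟨u, f, hfu, hf, hlt, hP⟩ := ih h (x ++ y) hxy (by
        simp only [List.length_cons, List.length_append] at hn ⊢; omega)
      obtain ⟨x, y, rfl, rfl, rfl⟩ := List.map_eq_append_iff.1 hfu
      have hmem : ∀ b ∈ n :: (x ++ n :: y), b = n ∨ b ∈ x ++ y := by
        intro b hb
        simp only [List.mem_cons, List.mem_append] at hb ⊢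
        tauto
      have hF : ∀ b ∈ x ++ y, Function.update f n a b = f b := fun b hb =>
        Function.update_of_ne (hlt b hb).ne _ _
      have hfa : ∀ b ∈ x ++ y, f b ≠ a := fun b hb e =>
        ha (by rw [← List.map_append, ← e]; exact List.mem_map_of_mem hb)
      refine ⟨n :: (x ++ n :: y), Function.update f n a, ?_, ?_, ?_, of_allSplits hP x y rfl⟩
      · simp only [List.map_cons, List.map_append, Function.update_self]
        rw [List.map_congr_left fun b hb => hF b (List.mem_append_left _ hb),
          List.map_congr_left fun b hb => hF b (List.mem_append_right _ hb)]
      · intro b hb c hc hbc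
        rcases hmem b hb with rfl | hb' <;> rcases hmem c hc with rfl | hc'
        · rfl
        · rw [Function.update_self, hF c hc'] at hbc
          exact absurd hbc.symm (hfa c hc')
        · rw [Function.update_self, hF b hb'] at hbc
          exact absurd hbc (hfa b hb')
        · rw [hF b hb', hF c hc'] at hbc
          exact hf hb' hc' hbc
      · intro b hb
        rcases hmem b hb with rfl | hb
        · exact Nat.lt_succ_self _
        · exact (hlt b hb).trans (Nat.lt_succ_self _)

/-- A Gauss word and further letters, relabelled. -/
theorem of_allGauss_of_fresh {n : ℕ} (hn10 : n ≤ 10) {P : List ℕ → Bool}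
    (h : allGauss n P = true) (w E : List ℕ) (hw : IsGauss w) (hn : w.length = 2 * n)
    (hE : E.Nodup) (hwE : ∀ a ∈ E, a ∉ w) :
    ∃ (u : List ℕ) (F : ℕ → ℕ), u.map F = w ∧ (∀ i, F (10 + i) = E.getD i 0) ∧
      Set.InjOn F {a | a ∈ u ∨ 10 ≤ a ∧ a < 10 + E.length} ∧ (∀ a ∈ u, a < 10) ∧ P u = true := by
  obtain ⟨u, f, rfl, hf, hlt, hP⟩ := of_allGauss h w hw hn
  have hlt : ∀ a ∈ u, a < 10 := fun a ha => (hlt a ha).trans_le hn10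
  -- Representatives use letters below 10; the letters from 10 on stand for the letters of a move.
  let F : ℕ → ℕ := fun a => if a < 10 then f a else E.getD (a - 10) 0
  have hFu : ∀ a ∈ u, F a = f a := fun a ha => if_pos (hlt a ha)
  have hFE : ∀ i, F (10 + i) = E.getD i 0 := fun i => by simp [F]
  have hne : ∀ a ∈ u, ∀ i < E.length, F a ≠ F (10 + i) := by
    intro a ha i hi e
    rw [hFu a ha, hFE, List.getD_eq_getElem _ _ hi] at e
    exact hwE _ (List.getElem_mem hi) (e ▸ List.mem_map_of_mem ha)
  refine ⟨u, F, List.map_congr_left hFu, hFE, ?_, hlt, hP⟩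
  have hcase : ∀ a, (a ∈ u ∨ 10 ≤ a ∧ a < 10 + E.length) → a ∈ u ∨ ∃ i < E.length, a = 10 + i := by
    rintro a (ha | ⟨h₁, h₂⟩)
    · exact Or.inl ha
    · exact Or.inr ⟨a - 10, by omega, by omega⟩
  intro a ha b hb hab
  rcases hcase a ha with ha | ⟨i, hi, rfl⟩ <;> rcases hcase b hb with hb | ⟨j, hj, rfl⟩
  · rw [hFu a ha, hFu b hb] at hab
    exact hf ha hb hab
  · exact absurd hab (hne a ha j hj)
  · exact absurd hab.symm (hne b hb i hi)
  · rw [hFE, hFE, List.getD_eq_getElem _ _ hi, List.getD_eq_getElem _ _ hj] at hab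
    rw [hE.getElem_inj_iff.1 hab]

/-! ### Weight systems -/

/-- Functions on words that satisfy the relations of the Polyak algebra of Gauss words of rank at
most 5 and vanish on the empty word. -/
structure IsWeight {M : Type*} [AddCommGroup M] (δ : List ℕ → M) : Prop where
  iso : ∀ {v w : List ℕ}, WordIso v w → δ v = δ w
  nil : δ [] = 0
  length : ∀ {w : List ℕ}, 10 < w.length → δ w = 0
  h1 : ∀ (x y : List ℕ) (A : ℕ), IsGauss (x ++ [A, A] ++ y) → δ (x ++ [A, A] ++ y) = 0
  h2 : ∀ (x y z : List ℕ) (A B : ℕ), IsGauss (x ++ [A, B] ++ y ++ [B, A] ++ z) →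
    δ (x ++ [A, B] ++ y ++ [B, A] ++ z) + δ (x ++ [A] ++ y ++ [A] ++ z)
      + δ (x ++ [B] ++ y ++ [B] ++ z) = 0
  -- Subwords with at most one of `A`, `B`, `C` are the same on both sides and are left out.
  h3 : ∀ (x y z t : List ℕ) (A B C : ℕ),
    IsGauss (x ++ [A, B] ++ y ++ [A, C] ++ z ++ [B, C] ++ t) →
    δ (x ++ [A, B] ++ y ++ [A, C] ++ z ++ [B, C] ++ t)
      + δ (x ++ [A, B] ++ y ++ [A] ++ z ++ [B] ++ t)
      + δ (x ++ [A] ++ y ++ [A, C] ++ z ++ [C] ++ t)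
      + δ (x ++ [B] ++ y ++ [C] ++ z ++ [B, C] ++ t)
    = δ (x ++ [B, A] ++ y ++ [C, A] ++ z ++ [C, B] ++ t)
      + δ (x ++ [B, A] ++ y ++ [A] ++ z ++ [B] ++ t)
      + δ (x ++ [A] ++ y ++ [C, A] ++ z ++ [C] ++ t)
      + δ (x ++ [B] ++ y ++ [C] ++ z ++ [C, B] ++ t)

namespace IsWeight

variable {M N : Type*} [AddCommGroup M] [AddCommGroup N]

theorem map {δ : List ℕ → M} (h : IsWeight δ) (f : M →+ N) : IsWeight fun w => f (δ w) where
  iso e := congrArg f (h.iso e)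
  nil := by rw [h.nil, map_zero]
  length e := by rw [h.length e, map_zero]
  h1 x y A e := by rw [h.h1 x y A e, map_zero]
  h2 x y z A B e := by simp only [← map_add]; rw [h.h2 x y z A B e, map_zero]
  h3 x y z t A B C e := by simp only [← map_add]; rw [h.h3 x y z t A B C e]

end IsWeight

/-! ### The weight system of the table -/

open Classical in
/-- The weight system given by the table. -/
noncomputable def tableWeight (w : List ℕ) : Target :=
  (wordVectors.map fun e => if WordIso e.1 w then e.2 else 0).sum

/-- Binary search trees with numerical keys and values. -/
inductive CodeTree : Type
  | leaf : CodeTree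
  | tip (k v : ℕ) : CodeTree
  | node (l : CodeTree) (k v : ℕ) (r : CodeTree) : CodeTree

namespace CodeTree

/-- The value at a key, zero if the key is not found. -/
noncomputable def find (t : CodeTree) (q : ℕ) : ℕ :=
  CodeTree.rec (motive := fun _ => ℕ) 0 (fun k v => cond (Nat.beq q k) v 0)
    (fun _ k v _ l r => cond (Nat.beq q k) v (cond (Nat.ble q k) l r)) t

/-- The keys of a tree. -/
def keys : CodeTree → List ℕ
  | leaf => []
  | tip k _ => [k]
  | node l k _ r => k :: (l.keys ++ r.keys)

/-- No ordering of the tree is needed: whichever branch the search takes, a nonzero result requires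
hitting a key. Successful searches are checked by evaluation in `tableTree_find`. -/
theorem find_eq_zero (t : CodeTree) (q : ℕ) (h : q ∉ t.keys) : t.find q = 0 := by
  induction t with
  | leaf => rfl
  | tip k v =>
    have : Nat.beq q k = false := Bool.eq_false_iff.2 fun e =>
      h (by simp [keys, Nat.eq_of_beq_eq_true e])
    change cond (Nat.beq q k) v 0 = 0
    rw [this, cond_false]
  | node l k v r ihl ihr =>
    simp only [keys, List.mem_cons, List.mem_append, not_or] at h
    have : Nat.beq q k = false := Bool.eq_false_iff.2 fun e => h.1 (Nat.eq_of_beq_eq_true e)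
    change cond (Nat.beq q k) v (cond (Nat.ble q k) (l.find q) (r.find q)) = 0
    rw [this, cond_false, ihl h.2.1, ihr h.2.2, Bool.cond_self]

end CodeTree

/-- The codes of the words of the table, with the encoded vectors. -/
def tableTree : CodeTree :=
  .node (.node (.node (.node (.node (.node (.node (.tip 605242145 1) 826426145 123 .leaf)
  891622177 123 (.tip 1380270369 1)) 1393894177 1 (.node (.node (.tip 1650660129 123) 1684160801
  120 .leaf) 82984649505 4 (.tip 86523593505 4))) 87566730017 4 (.node (.node (.node (.tip
  95385101089 4) 95603082017 4 .leaf) 99711337249 4 (.tip 151687349025 2)) 154974634785 66 (.node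
  (.tip 155981267745 2) 156252717857 32 (.tip 156286141217 48)))) 159237096225 2 (.node (.node
  (.node (.node (.tip 159252824865 2) 159740412705 32 .leaf) 160007799585 2 (.tip 163550806817
  98)) 164104573729 72 (.node (.node (.tip 164305781537 2) 168430748449 48 .leaf) 168696169249
  224 (.tip 168966820641 120))) 211613467425 2 (.node (.node (.node (.tip 211833668385 130)
  211865125665 2 .leaf) 212137558817 114 (.tip 216111858465 2)) 223693062945 2 (.node (.tip
  224988840737 2) 227939795745 2 (.tip 227971253025 120))))) 228191453985 2 (.node (.node (.node
  (.node (.node (.tip 228238639905 8) 229284057889 2 .leaf) 232270218017 120 (.tip 232287183649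
  10)) 232538587937 120 (.node (.node (.tip 232555615009 96) 233025192737 24 .leaf) 233041904417
  112 (.tip 233310589729 2))) 236613419809 26 (.node (.node (.node (.tip 236881789729 2)
  237684204321 250 .leaf) 237685248801 98 (.tip 279797121825 2)) 280064508705 240 (.node (.tip
  280552096545 2) 280567825185 2 (.tip 280823546657 240)))) 280840258337 2 (.node (.node (.node
  (.node (.tip 283823653665 2) 284830286625 16 .leaf) 284861743905 8 (.tip 285135160097 2))
  288117572385 2 (.node (.tip 289413350177 2) 300972917537 8 (.tip 301241287457 2))) 301275103521
  170 (.node (.node (.node (.tip 301476234017 16) 301492945697 2 .leaf) 305598251809 240 (.tip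
  305600217889 2)) 305866621729 2 (.node (.tip 305867604769 2) 306404737313 104 (.tip
  349559923489 48)))))) 353281327905 24 (.node (.node (.node (.node (.node (.node (.tip
  353854886689 4) 353871675681 250 .leaf) 356820271905 24 (.tip 358116303649 32)) 358133076769
  198 (.node (.node (.tip 369977803041 2) 370195899169 2 .leaf) 374051513121 58 (.tip
  374319944481 198))) 374321004833 224 (.node (.node (.node (.tip 374586286881 208) 374587331361
  4 .leaf) 374855778593 224 (.tip 417507648289 224)) 417725629217 224 (.node (.tip 421802611489
  2) 422003819297 2 (.tip 422071058721 2)))) 422305927969 96 (.node (.node (.node (.node (.tip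
  422322716961 2) 425543746337 120 .leaf) 425560711969 2 (.tip 425829143329 2)) 426298721057 2
  (.node (.tip 426567344929 2) 426584118049 120 (.tip 429805224737 2))) 429821936417 96 (.node
  (.node (.node (.tip 430056882977 2) 430124122401 224 .leaf) 430325252897 2 (.tip 434402312481
  2)) 434620408609 2 (.node (.tip 443042435873 2) 486258393889 152 (.tip 486794404641 120)))))
  490553295649 2 (.node (.node (.node (.node (.node (.tip 490818716449 4) 490820682529 112 .leaf)
  491090428193 178 (.tip 491360817953 16)) 494311457569 112 (.node (.node (.tip 494579827489 2)
  495382242081 198 .leaf) 495655658273 2 (.tip 495655719713 2))) 498604393249 2 (.node (.node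
  (.node (.tip 498605376289 2) 498871780129 198 .leaf) 498873746209 120 (.tip 499950698785 240))
  502900532001 114 (.node (.tip 503170023713 170) 503435305761 4 (.tip 503436350241 16))))
  507466945313 2 (.node (.node (.node (.node (.tip 560547840801 2) 560561603361 58 .leaf)
  560563569441 2 (.tip 560580596513 162)) 564809319201 170 (.node (.tip 564826030881 48)
  564856505121 2 (.tip 564857488161 2))) 564873470753 48 (.node (.node (.node (.tip 564874515233
  170) 569169494305 224 .leaf) 573398393633 104 (.tip 573416227105 48)) 573429850913 48 (.node
  (.tip 573447684385 104) 577713148705 32 (.tip 577746649377 120))))))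
/-- The element of `Target` encoded by a number below 256. -/
def decode (n : ℕ) : Target := (fun i => if n.testBit (i + 2) then 1 else 0, (n : ZMod 4))

/-- Addition of encoded elements of `Target`. -/
def encAdd (a b : ℕ) : ℕ :=
  Nat.add (Nat.mul 4 (Nat.xor (Nat.div a 4) (Nat.div b 4))) (Nat.mod (Nat.add a b) 4)

theorem encAdd_eq (a b : ℕ) : encAdd a b = 4 * ((a / 4) ^^^ (b / 4)) + (a + b) % 4 := rfl

theorem decode_zero : decode 0 = 0 := by
  refine Prod.ext (funext fun i => ?_) ?_ <;> simp [decode]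

/-- Bits 2 to 7 carry the entries modulo 2, which add by exclusive or. The two lowest bits carry the
entry modulo 4, and the cast to `ZMod 4` sees only them. -/
theorem decode_encAdd (a b : ℕ) : decode (encAdd a b) = decode a + decode b := by
  refine Prod.ext (funext fun i => ?_) ?_
  · have h := Nat.testBit_two_pow_mul_add (i := 2) ((a / 4) ^^^ (b / 4))
      (Nat.mod_lt (a + b) (by norm_num : 0 < 2 ^ 2)) (i.val + 2)
    have ha : (a / 4).testBit i = a.testBit (i + 2) := by
      rw [show 4 = 2 ^ 2 from rfl, Nat.testBit_div_two_pow]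
    have hb : (b / 4).testBit i = b.testBit (i + 2) := by
      rw [show 4 = 2 ^ 2 from rfl, Nat.testBit_div_two_pow]
    have e : (encAdd a b).testBit (i + 2) = (a.testBit (i + 2) ^^ b.testBit (i + 2)) := by
      rw [← ha, ← hb, ← Nat.testBit_xor]
      simpa [encAdd_eq] using h
    simp only [decode, Prod.fst_add, Pi.add_apply, e]
    cases a.testBit (i + 2) <;> cases b.testBit (i + 2) <;> decide
  · have h4 : (4 : ZMod 4) = 0 := rfl
    simp only [decode, encAdd_eq, Prod.snd_add]
    push_cast
    rw [h4, zero_mul, zero_add, ← Nat.cast_add]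
    exact (ZMod.natCast_eq_natCast_iff _ _ _).2 (Nat.mod_modEq _ _)

theorem wordVectors_length : ∀ e ∈ wordVectors, e.1.length ≤ 10 := by decide +kernel

theorem wordVectors_code_nodup : (wordVectors.map fun e => code e.1).Nodup := by decide +kernel

theorem tableTree_find : ∀ e ∈ wordVectors, decode (tableTree.find (code e.1)) = e.2 := by
  decide +kernel

theorem tableTree_keys : ∀ k ∈ tableTree.keys, k ∈ wordVectors.map fun e => code e.1 := by
  decide +kernel

theorem sum_ite_eq_of_nodup {α M : Type*} [AddCommMonoid M] (k : α → ℕ) (v : α → M)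
    (q : ℕ) : ∀ l : List α, (l.map k).Nodup →
    (∀ e ∈ l, k e = q → (l.map fun e => if k e = q then v e else 0).sum = v e) ∧
    (q ∉ l.map k → (l.map fun e => if k e = q then v e else 0).sum = 0)
  | [], _ => by simp
  | a :: l, h => by
    rw [List.map_cons, List.nodup_cons] at h
    obtain ⟨ih₁, ih₂⟩ := sum_ite_eq_of_nodup k v q l h.2
    refine ⟨fun e he hq => ?_, fun hq => ?_⟩
    · rcases List.mem_cons.1 he with rfl | he
      · have := ih₂ (hq ▸ h.1)
        simp [hq, this]
      · have hne : k a ≠ q := fun e' => h.1 (by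
          rw [e', ← hq]; exact List.mem_map_of_mem he)
        simp [hne, ih₁ e he hq]
    · simp only [List.map_cons, List.mem_cons, not_or] at hq
      simp [Ne.symm hq.1, ih₂ hq.2]

open Classical in
-- The codes in the table are distinct, so at most one summand survives, and the tree returns its
-- vector.
theorem tableWeight_eq_decode {w : List ℕ} (hw : w.length ≤ 15) :
    tableWeight w = decode (tableTree.find (code w)) := by
  have h : tableWeight w =
      (wordVectors.map fun e => if code e.1 = code w then e.2 else 0).sum := by
    refine congrArg List.sum (List.map_congr_left fun e he => ?_)
    have hl := wordVectors_length e he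
    exact if_congr ⟨WordIso.code_eq, wordIso_of_code_eq (by omega) hw⟩ rfl rfl
  obtain ⟨h₁, h₂⟩ := sum_ite_eq_of_nodup (fun e : List ℕ × Target => code e.1)
    (fun e => e.2) (code w) wordVectors wordVectors_code_nodup
  rw [h]
  by_cases hq : code w ∈ wordVectors.map fun e => code e.1
  · obtain ⟨e, he, hc⟩ := List.mem_map.1 hq
    rw [h₁ e he hc, ← hc, tableTree_find e he]
  · rw [h₂ hq, CodeTree.find_eq_zero _ _ fun hk => hq (tableTree_keys _ hk), decode_zero]

open Classical in
theorem tableWeight_eq_zero_of_length {w : List ℕ} (hw : 10 < w.length) : tableWeight w = 0 := by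
  refine List.sum_eq_zero fun v hv => ?_
  obtain ⟨e, he, rfl⟩ := List.mem_map.1 hv
  refine if_neg fun h => ?_
  have := wordVectors_length e he
  have := h.length_eq
  omega

open Classical in
theorem tableWeight_congr {v w : List ℕ} (h : WordIso v w) : tableWeight v = tableWeight w := by
  refine congrArg List.sum (List.map_congr_left fun e _ => if_congr ?_ rfl rfl)
  rw [wordIso_iff_pattern_eq, wordIso_iff_pattern_eq, h.pattern_eq]

/-! ### Verification of the relations on representatives -/

/-- The encoded value of the table on a word that is given in pieces. -/
noncomputable def encWeight (ps : List (List ℕ)) : ℕ := tableTree.find (scanCode ps)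

/-- Five or more further letters give a word of rank above 5, where the weight is zero by length. -/
theorem check_h1 : (List.range 5).all (fun r => allGauss r fun u => allSplits u fun x y =>
    Nat.beq (encWeight [x, [10, 10], y]) 0) = true := by
  decide +kernel

/-- Evaluation of the second relation. -/
noncomputable def h2Holds (x y z : List ℕ) (A B : ℕ) : Bool :=
  Nat.beq (encAdd (encAdd (encWeight [x, [A, B], y, [B, A], z])
    (encWeight [x, [A], y, [A], z])) (encWeight [x, [B], y, [B], z])) 0

theorem check_h2 : (List.range 4).all (fun r => allGauss r fun u => allSplits u fun x v =>
    allSplits v fun y z => h2Holds x y z 10 11) = true := by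
  decide +kernel

/-- Evaluation of the third relation. -/
noncomputable def h3Holds (x y z t : List ℕ) (A B C : ℕ) : Bool :=
  Nat.beq
    (encAdd (encAdd (encAdd (encWeight [x, [A, B], y, [A, C], z, [B, C], t])
      (encWeight [x, [A, B], y, [A], z, [B], t]))
      (encWeight [x, [A], y, [A, C], z, [C], t]))
      (encWeight [x, [B], y, [C], z, [B, C], t]))
    (encAdd (encAdd (encAdd (encWeight [x, [B, A], y, [C, A], z, [C, B], t])
      (encWeight [x, [B, A], y, [A], z, [B], t]))
      (encWeight [x, [A], y, [C, A], z, [C], t]))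
      (encWeight [x, [B], y, [C], z, [C, B], t]))

/-- With four or more further letters all eight words have rank at least 6. Words of rank 6 arising
here get the value zero because their codes are not in the tree. -/
theorem check_h3 : (List.range 4).all (fun r => allGauss r fun u => allSplits u fun x v =>
    allSplits v fun y v => allSplits v fun z t => h3Holds x y z t 10 11 12) = true := by
  decide +kernel

theorem wordVectors_two_smul : ∀ e ∈ wordVectors, e.1.length = 10 → e.2 + e.2 = 0 := by
  decide +kernel

open Classical in
-- The rows of rank 5 have last entry 0 or 2, so they are 2-torsion.
theorem tableWeight_add_self {w : List ℕ} (hw : 10 ≤ w.length) :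
    tableWeight w + tableWeight w = 0 := by
  have h : ∀ l : List (List ℕ × Target), (∀ e ∈ l, e ∈ wordVectors) →
      (l.map fun e => if WordIso e.1 w then e.2 else 0).sum
        + (l.map fun e => if WordIso e.1 w then e.2 else 0).sum = 0 := by
    intro l
    induction l with
    | nil => intro _; simp
    | cons e l ih =>
      intro hl
      rw [List.map_cons, List.sum_cons, add_add_add_comm, ih fun e he => hl e (by simp [he]),
        add_zero]
      split_ifs with hi
      · have he := hl e (by simp)
        have h₁ := wordVectors_length e he
        have h₂ := hi.length_eq
        exact wordVectors_two_smul e he (by omega)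
      · exact add_zero 0
  exact h wordVectors fun _ h => h

theorem tableWeight_map_flatten {F : ℕ → ℕ} {S : Set ℕ} (hF : Set.InjOn F S)
    (ps : List (List ℕ)) (hS : ∀ a ∈ ps.flatten, a ∈ S ∧ a < 16) (hl : ps.flatten.length ≤ 15) :
    tableWeight (ps.flatten.map F) = decode (encWeight ps) := by
  rw [← tableWeight_congr (wordIso_map (hF.mono fun a ha => (hS a ha).1)),
    tableWeight_eq_decode hl, encWeight, scanCode_eq_code ps (fun a ha => (hS a ha).2) hl]

/-! ### Distinctness and freshness of the letters in a move -/

theorem IsGauss.of_h1 {x y : List ℕ} {A : ℕ} (h : IsGauss (x ++ [A, A] ++ y)) :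
    A ∉ x ++ y ∧ IsGauss (x ++ y) := by
  have hp : (x ++ [A, A] ++ y).Perm (A :: A :: (x ++ y)) :=
    List.perm_iff_count.2 fun a => by simp [List.count_cons]; omega
  exact (h.of_perm hp).of_cons_cons

theorem IsGauss.of_h2 {x y z : List ℕ} {A B : ℕ} (h : IsGauss (x ++ [A, B] ++ y ++ [B, A] ++ z)) :
    IsGauss (x ++ y ++ z) ∧ A ≠ B ∧ A ∉ x ++ y ++ z ∧ B ∉ x ++ y ++ z := by
  have hp : (x ++ [A, B] ++ y ++ [B, A] ++ z).Perm (A :: A :: B :: B :: (x ++ y ++ z)) :=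
    List.perm_iff_count.2 fun a => by simp [List.count_cons]; omega
  obtain ⟨hA, h⟩ := (h.of_perm hp).of_cons_cons
  obtain ⟨hB, h⟩ := h.of_cons_cons
  simp only [List.mem_cons, not_or] at hA
  exact ⟨h, hA.1, hA.2.2, hB⟩

theorem IsGauss.of_h3 {x y z t : List ℕ} {A B C : ℕ}
    (h : IsGauss (x ++ [A, B] ++ y ++ [A, C] ++ z ++ [B, C] ++ t)) :
    IsGauss (x ++ y ++ z ++ t) ∧ [A, B, C].Nodup ∧ ∀ a ∈ [A, B, C], a ∉ x ++ y ++ z ++ t := by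
  have hp : (x ++ [A, B] ++ y ++ [A, C] ++ z ++ [B, C] ++ t).Perm
      (A :: A :: B :: B :: C :: C :: (x ++ y ++ z ++ t)) :=
    List.perm_iff_count.2 fun a => by simp [List.count_cons]; omega
  obtain ⟨hA, h⟩ := (h.of_perm hp).of_cons_cons
  obtain ⟨hB, h⟩ := h.of_cons_cons
  obtain ⟨hC, h⟩ := h.of_cons_cons
  simp only [List.mem_cons, not_or] at hA hB
  refine ⟨h, ?_, ?_⟩
  · simp only [List.nodup_cons, List.mem_cons, List.not_mem_nil]
    tauto
  · simp only [List.mem_cons, List.not_mem_nil]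
    rintro a (rfl | rfl | rfl | ha)
    · exact hA.2.2.2.2
    · exact hB.2.2
    · exact hC
    · exact ha.elim

/-- The transposition of `A` and `B` is the isomorphism, as neither letter occurs in `x`, `y`, `z`.
-/
theorem wordIso_replace {x y z : List ℕ} {A B : ℕ} (hA : A ∉ x ++ y ++ z) (hB : B ∉ x ++ y ++ z) :
    WordIso (x ++ [A] ++ y ++ [A] ++ z) (x ++ [B] ++ y ++ [B] ++ z) := by
  have hs : ∀ l : List ℕ, A ∉ l → B ∉ l → l.map (Equiv.swap A B) = l := by
    intro l hA hB
    have h : ∀ a ∈ l, Equiv.swap A B a = id a := fun a ha =>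
      Equiv.swap_apply_of_ne_of_ne (ne_of_mem_of_not_mem ha hA) (ne_of_mem_of_not_mem ha hB)
    rw [List.map_congr_left h, List.map_id]
  simp only [List.mem_append, not_or] at hA hB
  have := wordIso_map (v := x ++ [A] ++ y ++ [A] ++ z) (Equiv.swap A B).injective.injOn
  simpa [hs x hA.1.1 hB.1.1, hs y hA.1.2 hB.1.2, hs z hA.2 hB.2] using this

theorem decode_eq_of_beq {a b : ℕ} (h : Nat.beq a b = true) : decode a = decode b :=
  congrArg decode (Nat.eq_of_beq_eq_true h)

theorem isWeight_tableWeight : IsWeight tableWeight where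
  iso := tableWeight_congr
  nil := by rw [tableWeight_eq_decode (by simp)]; exact decode_zero
  length := tableWeight_eq_zero_of_length
  h1 x y A h := by
    by_cases hl : 10 < (x ++ [A, A] ++ y).length
    · exact tableWeight_eq_zero_of_length hl
    obtain ⟨hA, hxy⟩ := h.of_h1
    obtain ⟨r, hr⟩ := hxy.exists_length_eq
    simp only [List.length_append, List.length_cons, List.length_nil] at hl hr
    obtain ⟨u, F, hu, hE, hF, hlt, hP⟩ := of_allGauss_of_fresh (n := r) (by omega)
      (List.all_eq_true.1 check_h1 r (List.mem_range.2 (by omega))) (x ++ y) [A] hxy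
      (by simpa using hr) (by simp) (by simpa using hA)
    obtain ⟨x, y, rfl, rfl, rfl⟩ := List.map_eq_append_iff.1 hu
    have hA : F 10 = A := hE 0
    subst hA
    have hP := of_allSplits hP x y rfl
    simp only [List.length_map] at hl hr
    have key := fun ps h => tableWeight_map_flatten hF ps h
    have hm : ∀ a, a ∈ x ++ y → (a ∈ x ++ y ∨ 10 ≤ a ∧ a < 10 + [F 10].length) ∧ a < 16 :=
      fun a ha => ⟨Or.inl ha, (hlt a ha).trans (by norm_num)⟩
    have e₁ := key [x, [10, 10], y] (by
      intro a ha
      simp at ha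
      rcases ha with ha | rfl | ha
      · exact hm a (by simp [ha])
      · simp
      · exact hm a (by simp [ha])) (by simp; omega)
    rw [decode_eq_of_beq hP, decode_zero] at e₁
    simpa using e₁
  h2 x y z A B h := by
    obtain ⟨hu, hAB, hA, hB⟩ := h.of_h2
    have e := tableWeight_congr (wordIso_replace hA hB)
    obtain ⟨r, hr⟩ := hu.exists_length_eq
    by_cases hl : r < 4
    · obtain ⟨u, F, hu, hE, hF, hlt, hP⟩ := of_allGauss_of_fresh (n := r) (by omega)
        (List.all_eq_true.1 check_h2 r (List.mem_range.2 (by omega))) (x ++ y ++ z) [A, B] hu hr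
        (by simpa using hAB) (by
          intro a ha
          simp only [List.mem_cons, List.not_mem_nil, or_false] at ha
          rcases ha with rfl | rfl <;> assumption)
      obtain ⟨v, z, rfl, hv, rfl⟩ := List.map_eq_append_iff.1 hu
      obtain ⟨x, y, rfl, rfl, rfl⟩ := List.map_eq_append_iff.1 hv
      have hA' : F 10 = A := hE 0
      have hB' : F 11 = B := hE 1
      subst hA' hB'
      have hP := of_allSplits (of_allSplits hP x (y ++ z) (List.append_assoc _ _ _).symm) y z rfl
      simp only [List.length_append, List.length_map] at hr
      have hm : ∀ a, (a ∈ x ++ y ++ z ∨ a = 10 ∨ a = 11) →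
          (a ∈ x ++ y ++ z ∨ 10 ≤ a ∧ a < 10 + [F 10, F 11].length) ∧ a < 16 := by
        rintro a (ha | rfl | rfl)
        · exact ⟨Or.inl ha, (hlt a ha).trans (by norm_num)⟩
        · simp
        · simp
      have key := fun ps (h : ∀ a ∈ ps.flatten, _) =>
        tableWeight_map_flatten hF ps fun a ha => hm a (h a ha)
      have e₁ := key [x, [10, 11], y, [11, 10], z] (by simp; tauto) (by simp; omega)
      have e₂ := key [x, [10], y, [10], z] (by simp; tauto) (by simp; omega)
      have e₃ := key [x, [11], y, [11], z] (by simp; tauto) (by simp; omega)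
      have hd := decode_eq_of_beq hP
      simp only [decode_encAdd, ← e₁, ← e₂, ← e₃, decode_zero] at hd
      simpa using hd
    -- The word with both letters has rank at least 6. The other two words are isomorphic of rank at
    -- least 5, so their common value is doubled and vanishes.
    · simp only [List.length_append] at hr
      rw [← e, tableWeight_eq_zero_of_length (by simp; omega), zero_add,
        tableWeight_add_self (by simp; omega)]
  h3 x y z t A B C h := by
    obtain ⟨hu, hnd, hfresh⟩ := h.of_h3
    obtain ⟨r, hr⟩ := hu.exists_length_eq
    by_cases hl : r < 4
    · obtain ⟨u, F, hu, hE, hF, hlt, hP⟩ := of_allGauss_of_fresh (n := r) (by omega)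
        (List.all_eq_true.1 check_h3 r (List.mem_range.2 (by omega))) (x ++ y ++ z ++ t) [A, B, C]
        hu hr hnd hfresh
      obtain ⟨v, t, rfl, hv, rfl⟩ := List.map_eq_append_iff.1 hu
      obtain ⟨v, z, rfl, hv', rfl⟩ := List.map_eq_append_iff.1 hv
      obtain ⟨x, y, rfl, rfl, rfl⟩ := List.map_eq_append_iff.1 hv'
      have hA' : F 10 = A := hE 0
      have hB' : F 11 = B := hE 1
      have hC' : F 12 = C := hE 2
      subst hA' hB' hC'
      have hP := of_allSplits (of_allSplits (of_allSplits hP x (y ++ (z ++ t)) (by simp))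
        y (z ++ t) rfl) z t rfl
      simp only [List.length_append, List.length_map] at hr
      have hm : ∀ a, (a ∈ x ++ y ++ z ++ t ∨ a = 10 ∨ a = 11 ∨ a = 12) →
          (a ∈ x ++ y ++ z ++ t ∨ 10 ≤ a ∧ a < 10 + [F 10, F 11, F 12].length) ∧ a < 16 := by
        rintro a (ha | rfl | rfl | rfl)
        · exact ⟨Or.inl ha, (hlt a ha).trans (by norm_num)⟩
        all_goals simp
      have key := fun ps (h : ∀ a ∈ ps.flatten, _) =>
        tableWeight_map_flatten hF ps fun a ha => hm a (h a ha)
      have e₁ := key [x, [10, 11], y, [10, 12], z, [11, 12], t] (by simp; tauto) (by simp; omega)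
      have e₂ := key [x, [10, 11], y, [10], z, [11], t] (by simp; tauto) (by simp; omega)
      have e₃ := key [x, [10], y, [10, 12], z, [12], t] (by simp; tauto) (by simp; omega)
      have e₄ := key [x, [11], y, [12], z, [11, 12], t] (by simp; tauto) (by simp; omega)
      have e₅ := key [x, [11, 10], y, [12, 10], z, [12, 11], t] (by simp; tauto) (by simp; omega)
      have e₆ := key [x, [11, 10], y, [10], z, [11], t] (by simp; tauto) (by simp; omega)
      have e₇ := key [x, [10], y, [12, 10], z, [12], t] (by simp; tauto) (by simp; omega)
      have e₈ := key [x, [11], y, [12], z, [12, 11], t] (by simp; tauto) (by simp; omega)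
      have hd := decode_eq_of_beq hP
      simp only [decode_encAdd, ← e₁, ← e₂, ← e₃, ← e₄, ← e₅, ← e₆, ← e₇, ← e₈] at hd
      simpa using hd
    · simp only [List.length_append] at hr
      have hz : ∀ w : List ℕ, 10 < w.length → tableWeight w = 0 := fun _ =>
        tableWeight_eq_zero_of_length
      rw [hz, hz, hz, hz, hz, hz, hz, hz] <;> simp <;> omega

/-! ### Subwords -/

theorem IsGauss.filter {w : List ℕ} (hw : IsGauss w) (p : ℕ → Bool) : IsGauss (w.filter p) :=
  fun a ha => by
    have h := List.mem_filter.1 ha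
    exact (List.count_filter (p := p) h.2).trans (hw a h.1)

/-- The subword of `w` formed by the letters in `S`. -/
def keep (S : Finset ℕ) (w : List ℕ) : List ℕ := w.filter fun a => a ∈ S

theorem IsGauss.keep {w : List ℕ} (hw : IsGauss w) (S : Finset ℕ) : IsGauss (keep S w) :=
  hw.filter _

/-- The subword of `w` formed by the letters not in `S`. -/
def drop (S : Finset ℕ) (w : List ℕ) : List ℕ := w.filter fun a => a ∉ S

section

variable {S T : Finset ℕ} {a : ℕ} {v w : List ℕ}

@[simp] theorem keep_nil : keep S [] = [] := rfl

@[simp] theorem keep_append : keep S (v ++ w) = keep S v ++ keep S w := List.filter_append _ _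

@[simp] theorem keep_cons : keep S (a :: w) = if a ∈ S then a :: keep S w else keep S w := by
  simp [keep, List.filter_cons]

@[simp] theorem drop_nil : drop S [] = [] := rfl

@[simp] theorem drop_append : drop S (v ++ w) = drop S v ++ drop S w := List.filter_append _ _

@[simp] theorem drop_cons : drop S (a :: w) = if a ∈ S then drop S w else a :: drop S w := by
  by_cases h : a ∈ S <;> simp [drop, h]

theorem keep_insert_of_notMem (h : a ∉ w) : keep (insert a S) w = keep S w :=
  List.filter_congr fun b hb => by
    have : b ≠ a := fun e => h (e ▸ hb)
    simp [this]

theorem drop_singleton_of_notMem (h : a ∉ w) : drop {a} w = w :=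
  List.filter_eq_self.2 fun b hb => by
    have : b ≠ a := fun e => h (e ▸ hb)
    simp [this]

theorem drop_drop : drop T (drop S w) = drop (S ∪ T) w := by
  simp only [drop, List.filter_filter]
  refine List.filter_congr fun b _ => ?_
  simp [Bool.and_comm]

theorem keep_drop : keep T (drop S w) = keep (T \ S) w := by
  simp only [drop, keep, List.filter_filter]
  refine List.filter_congr fun b _ => ?_
  simp

theorem toFinset_keep : (keep S w).toFinset = w.toFinset ∩ S := by
  ext b; simp [keep]

theorem toFinset_drop : (drop S w).toFinset = w.toFinset \ S := by
  ext b; simp [drop]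

theorem keep_toFinset : keep w.toFinset w = w :=
  List.filter_eq_self.2 fun b hb => by simpa using hb

theorem wordIso_keep_map {f : ℕ → ℕ} (hf : Set.InjOn f {a | a ∈ v}) (hT : T ⊆ v.toFinset) :
    WordIso (keep T v) (keep (T.image f) (v.map f)) := by
  have : keep (T.image f) (v.map f) = (keep T v).map f := by
    simp only [keep, List.filter_map]
    refine congrArg _ (List.filter_congr fun b hb => ?_)
    simp only [Function.comp, Finset.mem_image, decide_eq_decide]
    exact ⟨fun ⟨c, hc, e⟩ => hf (List.mem_toFinset.1 (hT hc)) hb e ▸ hc, fun h => ⟨b, h, rfl⟩⟩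
  rw [this]
  exact wordIso_map (hf.mono fun a ha => (List.mem_filter.1 ha).1)

theorem wordIso_drop_map {f : ℕ → ℕ} (hf : Set.InjOn f {a | a ∈ v}) (hT : T ⊆ v.toFinset) :
    WordIso (drop T v) (drop (T.image f) (v.map f)) := by
  have : drop (T.image f) (v.map f) = (drop T v).map f := by
    simp only [drop, List.filter_map]
    refine congrArg _ (List.filter_congr fun b hb => ?_)
    simp only [Function.comp, Finset.mem_image, decide_eq_decide, not_iff_not]
    exact ⟨fun ⟨c, hc, e⟩ => hf (List.mem_toFinset.1 (hT hc)) hb e ▸ hc, fun h => ⟨b, h, rfl⟩⟩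
  rw [this]
  exact wordIso_map (hf.mono fun a ha => (List.mem_filter.1 ha).1)

theorem sum_powerset_toFinset_map {M : Type*} [AddCommMonoid M] {f : ℕ → ℕ}
    (hf : Set.InjOn f {a | a ∈ v}) (g : Finset ℕ → M) :
    ∑ T ∈ (v.map f).toFinset.powerset, g T = ∑ T ∈ v.toFinset.powerset, g (T.image f) := by
  have h : (v.map f).toFinset = v.toFinset.image f := by ext; simp
  rw [h, Finset.powerset_image, Finset.sum_image]
  refine (Finset.image_injOn_powerset_of_injOn (s := v.toFinset) ?_).mono ?_
  · simpa [Set.InjOn] using hf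
  · simp

end

theorem toFinset_h1 (x y : List ℕ) (A : ℕ) :
    (x ++ [A, A] ++ y).toFinset = insert A (x ++ y).toFinset := by
  ext; simp

theorem toFinset_h2 (x y z : List ℕ) (A B : ℕ) :
    (x ++ [A, B] ++ y ++ [B, A] ++ z).toFinset = insert A (insert B (x ++ y ++ z).toFinset) := by
  ext; simp; tauto

theorem toFinset_h3 (x y z t : List ℕ) (A B C : ℕ) :
    (x ++ [A, B] ++ y ++ [A, C] ++ z ++ [B, C] ++ t).toFinset
      = insert A (insert B (insert C (x ++ y ++ z ++ t).toFinset)) := by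
  ext; simp

theorem IsGauss.h3_swap {x y z t : List ℕ} {A B C : ℕ}
    (h : IsGauss (x ++ [A, B] ++ y ++ [A, C] ++ z ++ [B, C] ++ t)) :
    IsGauss (x ++ [B, A] ++ y ++ [C, A] ++ z ++ [C, B] ++ t) :=
  h.of_perm (List.perm_iff_count.2 fun a => by simp [List.count_cons]; omega)

/-! ### The invariant of a weight system -/

section

variable {M : Type*} [AddCommGroup M] {δ : List ℕ → M}

/-- The sum of the values of `δ` on the subwords of a word. -/
def subwordSum (δ : List ℕ → M) (w : List ℕ) : M := ∑ S ∈ w.toFinset.powerset, δ (keep S w)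

theorem subwordSum_map (h : IsWeight δ) {f : ℕ → ℕ} {v : List ℕ}
    (hf : Set.InjOn f {a | a ∈ v}) : subwordSum δ (v.map f) = subwordSum δ v := by
  rw [subwordSum, sum_powerset_toFinset_map hf]
  exact Finset.sum_congr rfl fun T hT =>
    (h.iso (wordIso_keep_map hf (Finset.mem_powerset.1 hT))).symm

/-- Subsets of letters containing `A` leave a subword with `AA`, which contributes zero; the others
give the subwords of `xy`. -/
theorem subwordSum_h1 (h : IsWeight δ) {x y : List ℕ} {A : ℕ} (hw : IsGauss (x ++ [A, A] ++ y)) :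
    subwordSum δ (x ++ [A, A] ++ y) = subwordSum δ (x ++ y) := by
  obtain ⟨hA, -⟩ := hw.of_h1
  rw [subwordSum, toFinset_h1, Finset.sum_powerset_insert (by simpa using hA), subwordSum,
    ← Finset.sum_add_distrib]
  refine Finset.sum_congr rfl fun T hT => ?_
  have hAT : A ∉ T := fun e => hA (List.mem_toFinset.1 (Finset.mem_powerset.1 hT e))
  simp only [List.mem_append, not_or] at hA
  have hg := hw.keep (insert A T)
  have h₁ := h.h1 (keep T x) (keep T y) A
  simp [keep_insert_of_notMem, hA, hAT] at hg h₁ ⊢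
  exact h₁ hg

/-- Subsets are grouped by their part `T` outside `A`, `B`. The one avoiding both letters gives a
subword of `xyz`, and the other three cancel by the second relation. -/
theorem subwordSum_h2 (h : IsWeight δ) {x y z : List ℕ} {A B : ℕ}
    (hw : IsGauss (x ++ [A, B] ++ y ++ [B, A] ++ z)) :
    subwordSum δ (x ++ [A, B] ++ y ++ [B, A] ++ z) = subwordSum δ (x ++ y ++ z) := by
  obtain ⟨-, hAB, hA, hB⟩ := hw.of_h2
  rw [subwordSum, toFinset_h2,
    Finset.sum_powerset_insert (by simpa [hAB] using hA),
    Finset.sum_powerset_insert (by simpa using hB),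
    Finset.sum_powerset_insert (by simpa using hB), subwordSum]
  simp only [← Finset.sum_add_distrib]
  refine Finset.sum_congr rfl fun T hT => ?_
  have hT := Finset.mem_powerset.1 hT
  have hAT : A ∉ T := fun e => hA (List.mem_toFinset.1 (hT e))
  have hBT : B ∉ T := fun e => hB (List.mem_toFinset.1 (hT e))
  simp only [List.mem_append, not_or] at hA hB
  have hg := hw.keep (insert A (insert B T))
  have h₁ := h.h2 (keep T x) (keep T y) (keep T z) A B
  simp [keep_insert_of_notMem, hA, hB, hAT, hBT, hAB, hAB.symm] at hg h₁ ⊢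
  have := h₁ hg
  rw [← sub_eq_zero, ← this]
  abel

/-- Subsets are grouped by their part `T` outside `A`, `B`, `C`. Those with at most one of these
letters leave equal subwords on both sides, and the remaining four match by the third relation. -/
theorem subwordSum_h3 (h : IsWeight δ) {x y z t : List ℕ} {A B C : ℕ}
    (hw : IsGauss (x ++ [A, B] ++ y ++ [A, C] ++ z ++ [B, C] ++ t)) :
    subwordSum δ (x ++ [A, B] ++ y ++ [A, C] ++ z ++ [B, C] ++ t)
      = subwordSum δ (x ++ [B, A] ++ y ++ [C, A] ++ z ++ [C, B] ++ t) := by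
  obtain ⟨-, hnd, hfresh⟩ := hw.of_h3
  have hA := hfresh A (by simp)
  have hB := hfresh B (by simp)
  have hC := hfresh C (by simp)
  simp only [List.nodup_cons, List.mem_cons, List.not_mem_nil, or_false, not_or] at hnd
  obtain ⟨⟨hAB, hAC⟩, hBC, -⟩ := hnd
  have hS : (x ++ [B, A] ++ y ++ [C, A] ++ z ++ [C, B] ++ t).toFinset
      = (x ++ [A, B] ++ y ++ [A, C] ++ z ++ [B, C] ++ t).toFinset := by
    ext; simp; tauto
  have hA' : A ∉ insert B (insert C (x ++ y ++ z ++ t).toFinset) := by simpa [hAB, hAC] using hA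
  have hB' : B ∉ insert C (x ++ y ++ z ++ t).toFinset := by simpa [hBC] using hB
  have hC' : C ∉ (x ++ y ++ z ++ t).toFinset := by simpa using hC
  simp only [subwordSum]
  rw [hS, toFinset_h3]
  simp only [Finset.sum_powerset_insert hA', Finset.sum_powerset_insert hB',
    Finset.sum_powerset_insert hC', ← Finset.sum_add_distrib]
  refine Finset.sum_congr rfl fun T hT => ?_
  have hT := Finset.mem_powerset.1 hT
  have hAT : A ∉ T := fun e => hA (List.mem_toFinset.1 (hT e))
  have hBT : B ∉ T := fun e => hB (List.mem_toFinset.1 (hT e))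
  have hCT : C ∉ T := fun e => hC (List.mem_toFinset.1 (hT e))
  simp only [List.mem_append, not_or] at hA hB hC
  have hg := hw.keep (insert A (insert B (insert C T)))
  have h₁ := h.h3 (keep T x) (keep T y) (keep T z) (keep T t) A B C
  simp [keep_insert_of_notMem, hA, hB, hC, hAT, hBT, hCT, hAB, Ne.symm hAB, hAC,
    Ne.symm hAC, hBC, Ne.symm hBC] at hg h₁ ⊢
  have := h₁ hg
  rw [← sub_eq_zero] at this ⊢
  rw [← this]
  abel

theorem subwordSum_move (h : IsWeight δ) {v w : List ℕ} (hv : IsGauss v) (hm : Move v w) :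
    subwordSum δ v = subwordSum δ w := by
  cases hm with
  | iso _ _ hi =>
    obtain ⟨f, hf, rfl⟩ := hi
    exact (subwordSum_map h hf.injOn).symm
  | H1 x y A => exact subwordSum_h1 h hv
  | H2 x y z A B => exact subwordSum_h2 h hv
  | H3 x y z t A B C => exact subwordSum_h3 h hv

/-- The homotopy invariant of a weight system. -/
noncomputable def IsWeight.invariant (h : IsWeight δ) : ZP →+ M :=
  FreeAbelianGroup.lift (Quotient.lift (fun p : GaussWord => subwordSum δ p.1) fun p q hpq => by
    induction hpq with
    | rel p q hm => exact subwordSum_move h p.2 hm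
    | refl p => rfl
    | symm p q _ ih => exact ih.symm
    | trans p q r _ _ ih₁ ih₂ => exact ih₁.trans ih₂)

theorem IsWeight.invariant_cls (h : IsWeight δ) (p : GaussWord) :
    h.invariant (cls p) = subwordSum δ p.1 :=
  FreeAbelianGroup.lift_apply_of _ _

/-- Turning `A` into a semi-letter subtracts exactly the subwords that avoid `A`, so only those
containing all semi-letters survive. -/
theorem IsWeight.invariant_semiWord (h : IsWeight δ) (w : GaussWord) (S : Finset ℕ)
    (hS : S ⊆ w.letters) :
    h.invariant (semiWord w S) = ∑ R ∈ (w.letters \ S).powerset, δ (keep (R ∪ S) w.1) := by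
  induction S using Finset.induction_on generalizing w with
  | empty => simp [semiWord_empty, invariant_cls, subwordSum, GaussWord.letters]
  | insert A S hA ih =>
    have hAw : A ∈ w.letters := hS (Finset.mem_insert_self _ _)
    have hSw : S ⊆ w.letters := (Finset.subset_insert _ _).trans hS
    have hl : (w.delete {A}).letters = w.letters \ {A} := toFinset_drop
    have e : w.letters \ S = insert A (w.letters \ insert A S) := by
      ext b
      by_cases hb : b = A
      · simp [hb, hAw, hA]
      · simp [hb]
    rw [semiWord_insert _ _ _ hA, map_sub, ih w hSw, ih (w.delete {A}) (by
      rw [hl]; exact Finset.subset_sdiff.2 ⟨hSw, by simpa using hA⟩), e,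
      Finset.sum_powerset_insert (by simp), hl, sdiff_sdiff, Finset.sup_eq_union,
      ← Finset.insert_eq]
    have hd : ∀ R ∈ (w.letters \ insert A S).powerset,
        δ (keep (R ∪ S) (w.delete {A}).1) = δ (keep (R ∪ S) w.1) := by
      intro R hR
      have hAR : A ∉ R ∪ S := by
        rw [Finset.mem_union, not_or]
        exact ⟨fun h => by simpa using Finset.mem_powerset.1 hR h, hA⟩
      change δ (keep (R ∪ S) (drop {A} w.1)) = _
      rw [keep_drop, Finset.sdiff_eq_self_of_disjoint (Finset.disjoint_singleton_right.2 hAR)]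
    rw [Finset.sum_congr rfl hd, add_sub_cancel_left]
    refine Finset.sum_congr rfl fun R _ => ?_
    rw [Finset.insert_union, Finset.union_insert]

theorem IsWeight.invariant_semiWord_letters (h : IsWeight δ) (w : GaussWord) :
    h.invariant (semiWord w w.letters) = δ w.1 := by
  rw [h.invariant_semiWord w _ subset_rfl]
  simp [GaussWord.letters, keep_toFinset]

/-- Each surviving subword contains more than five letters, so `δ` vanishes on it. -/
theorem IsWeight.hasDegreeLE (h : IsWeight δ) : HasDegreeLE h.invariant 5 := by
  intro w S hS hc
  rw [h.invariant_semiWord w S hS]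
  refine Finset.sum_eq_zero fun R hR => h.length ?_
  have hR := Finset.mem_powerset.1 hR
  have hsub : S ⊆ w.1.toFinset ∩ (R ∪ S) :=
    Finset.subset_inter hS Finset.subset_union_right
  rw [(w.2.keep _).length_eq, toFinset_keep]
  have := Finset.card_le_card hsub
  omega

end

/-! ### The weight system of an invariant -/

section

variable {H : Type*} [AddCommGroup H] {v : ZP →+ H} {w w' : List ℕ} {S : Finset ℕ}

theorem IsGauss.drop (hw : IsGauss w) (S : Finset ℕ) : IsGauss (drop S w) := hw.filter _

open Classical in
/-- The value of an invariant on a word, zero if the word is not a Gauss word. -/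
noncomputable def evalWord (v : ZP →+ H) (w : List ℕ) : H :=
  if h : IsGauss w then v (cls ⟨w, h⟩) else 0

theorem evalWord_of_isGauss (h : IsGauss w) : evalWord v w = v (cls ⟨w, h⟩) := dif_pos h

theorem evalWord_move (h : IsGauss w) (h' : IsGauss w') (hm : Move w w') :
    evalWord v w = evalWord v w' := by
  rw [evalWord_of_isGauss h, evalWord_of_isGauss h']
  exact congrArg (fun p => v (FreeAbelianGroup.of p))
    (Quotient.sound (s := homotopy) (Relation.EqvGen.rel _ _ hm))

/-- The value of an invariant on the word `w` in which the letters in `S` are semi-letters. -/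
noncomputable def evalSemi (v : ZP →+ H) (w : List ℕ) (S : Finset ℕ) : H :=
  ∑ T ∈ S.powerset, (-1 : ℤ) ^ T.card • evalWord v (drop T w)

theorem map_semiWord (p : GaussWord) (S : Finset ℕ) : v (semiWord p S) = evalSemi v p.1 S := by
  rw [semiWord, map_sum, evalSemi]
  refine Finset.sum_congr rfl fun T _ => ?_
  rw [map_zsmul, evalWord_of_isGauss (p.2.drop T)]
  rfl

theorem evalSemi_insert {A : ℕ} (hA : A ∉ S) :
    evalSemi v w (insert A S) = evalSemi v w S - evalSemi v (drop {A} w) S := by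
  rw [evalSemi, Finset.sum_powerset_insert hA, sub_eq_add_neg, evalSemi, evalSemi,
    ← Finset.sum_neg_distrib]
  congr 1
  refine Finset.sum_congr rfl fun T hT => ?_
  have hAT : A ∉ T := fun h => hA (Finset.mem_powerset.1 hT h)
  rw [Finset.card_insert_of_notMem hAT, drop_drop, ← Finset.insert_eq, pow_succ]
  simp

theorem evalSemi_congr (h : ∀ T ⊆ S, evalWord v (drop T w) = evalWord v (drop T w')) :
    evalSemi v w S = evalSemi v w' S :=
  Finset.sum_congr rfl fun T hT => by rw [h T (Finset.mem_powerset.1 hT)]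

open Classical in
/-- The value of an invariant on the Gauss word `w` with semi-letters only. -/
noncomputable def symbol (v : ZP →+ H) (w : List ℕ) : H :=
  if IsGauss w then evalSemi v w w.toFinset else 0

theorem symbol_of_isGauss (h : IsGauss w) : symbol v w = evalSemi v w w.toFinset := if_pos h

theorem symbol_eq (p : GaussWord) : symbol v p.1 = v (semiWord p p.letters) := by
  rw [symbol_of_isGauss p.2, map_semiWord]; rfl

theorem symbol_iso (h : WordIso w w') : symbol v w = symbol v w' := by
  by_cases hw : IsGauss w
  · rw [symbol_of_isGauss hw, symbol_of_isGauss (h.isGauss hw)]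
    obtain ⟨f, hf, rfl⟩ := h
    rw [evalSemi, evalSemi, sum_powerset_toFinset_map hf.injOn]
    refine Finset.sum_congr rfl fun T hT => ?_
    have hT := Finset.mem_powerset.1 hT
    have hi := wordIso_drop_map hf.injOn hT
    have hd := hw.drop T
    rw [evalWord_move hd (hi.isGauss hd) (Move.iso _ _ hi), Finset.card_image_of_injOn]
    exact hf.injOn.mono fun a ha => List.mem_toFinset.1 (hT ha)
  · have hw' : ¬ IsGauss w' := fun hw' => hw (h.symm.isGauss hw')
    rw [symbol, symbol, if_neg hw, if_neg hw']

theorem symbol_h1 {x y : List ℕ} {A : ℕ} (hw : IsGauss (x ++ [A, A] ++ y)) :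
    symbol v (x ++ [A, A] ++ y) = 0 := by
  obtain ⟨hA, hxy⟩ := hw.of_h1
  rw [symbol_of_isGauss hw, toFinset_h1, evalSemi_insert (by simpa using hA), sub_eq_zero]
  refine evalSemi_congr fun T hT => ?_
  have hAT : A ∉ T := fun e => hA (List.mem_toFinset.1 (hT e))
  simp only [List.mem_append, not_or] at hA
  have hm := Move.H1 (drop T x) (drop T y) A
  have hg := hw.drop T
  have hg' := hxy.drop T
  simp [drop_singleton_of_notMem, hA, hAT] at hm hg hg' ⊢
  exact evalWord_move hg hg' hm

/-- Let `W(X)` be the value with the letters `X` out of `A`, `B` kept and all further letters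
semi-letters. The three symbols are `W(AB) - W(A) - W(B) + W(∅)`, `W(A) - W(∅)` and `W(B) - W(∅)`.
They add up to `W(AB) - W(∅)`, which is zero by the second move. -/
theorem symbol_h2 {x y z : List ℕ} {A B : ℕ}
    (hw : IsGauss (x ++ [A, B] ++ y ++ [B, A] ++ z)) :
    symbol v (x ++ [A, B] ++ y ++ [B, A] ++ z) + symbol v (x ++ [A] ++ y ++ [A] ++ z)
      + symbol v (x ++ [B] ++ y ++ [B] ++ z) = 0 := by
  obtain ⟨hu, hAB, hA, hB⟩ := hw.of_h2
  have hA' : A ∉ (x ++ y ++ z).toFinset := by simpa using hA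
  have hB' : B ∉ (x ++ y ++ z).toFinset := by simpa using hB
  have hAB' : A ∉ insert B (x ++ y ++ z).toFinset := by simpa [hAB] using hA
  have key : evalSemi v (x ++ [A, B] ++ y ++ [B, A] ++ z) (x ++ y ++ z).toFinset
      = evalSemi v (x ++ y ++ z) (x ++ y ++ z).toFinset := by
    refine evalSemi_congr fun T hT => ?_
    have hAT : A ∉ T := fun e => hA' (hT e)
    have hBT : B ∉ T := fun e => hB' (hT e)
    have hm := Move.H2 (drop T x) (drop T y) (drop T z) A B
    have hg := hw.drop T
    have hg' := hu.drop T
    simp [hAT, hBT] at hm hg hg' ⊢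
    exact evalWord_move hg hg' hm
  simp only [List.mem_append, not_or] at hA hB
  have hgA := hw.drop {B}
  have hgB := hw.drop {A}
  simp [drop_singleton_of_notMem, hA, hB, hAB, Ne.symm hAB] at hgA hgB
  have eA : (x ++ [A] ++ y ++ [A] ++ z).toFinset = insert A (x ++ y ++ z).toFinset := by
    ext; simp
  have eB : (x ++ [B] ++ y ++ [B] ++ z).toFinset = insert B (x ++ y ++ z).toFinset := by
    ext; simp
  rw [symbol_of_isGauss hw, symbol_of_isGauss (by simpa using hgA),
    symbol_of_isGauss (by simpa using hgB), toFinset_h2, eA, eB]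
  simp only [evalSemi_insert hAB', evalSemi_insert hA', evalSemi_insert hB', key]
  simp [drop_singleton_of_notMem, hA, hB, hAB, Ne.symm hAB]
  abel

/-- In the same notation each side equals `W(ABC) - W(A) - W(B) - W(C) + 2 W(∅)`. The third move
identifies the terms `W(ABC)`, and the words with at most one of the three letters coincide. -/
theorem symbol_h3 {x y z t : List ℕ} {A B C : ℕ}
    (hw : IsGauss (x ++ [A, B] ++ y ++ [A, C] ++ z ++ [B, C] ++ t)) :
    symbol v (x ++ [A, B] ++ y ++ [A, C] ++ z ++ [B, C] ++ t)
      + symbol v (x ++ [A, B] ++ y ++ [A] ++ z ++ [B] ++ t)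
      + symbol v (x ++ [A] ++ y ++ [A, C] ++ z ++ [C] ++ t)
      + symbol v (x ++ [B] ++ y ++ [C] ++ z ++ [B, C] ++ t)
    = symbol v (x ++ [B, A] ++ y ++ [C, A] ++ z ++ [C, B] ++ t)
      + symbol v (x ++ [B, A] ++ y ++ [A] ++ z ++ [B] ++ t)
      + symbol v (x ++ [A] ++ y ++ [C, A] ++ z ++ [C] ++ t)
      + symbol v (x ++ [B] ++ y ++ [C] ++ z ++ [C, B] ++ t) := by
  obtain ⟨hu, hnd, hfresh⟩ := hw.of_h3
  have hA := hfresh A (by simp)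
  have hB := hfresh B (by simp)
  have hC := hfresh C (by simp)
  simp only [List.nodup_cons, List.mem_cons, List.not_mem_nil, or_false, not_or] at hnd
  obtain ⟨⟨hAB, hAC⟩, hBC, -⟩ := hnd
  set U := (x ++ y ++ z ++ t).toFinset with hU
  have hAU : A ∉ U := by simpa [hU] using hA
  have hBU : B ∉ U := by simpa [hU] using hB
  have hCU : C ∉ U := by simpa [hU] using hC
  have hBA := Ne.symm hAB
  have hCA := Ne.symm hAC
  have hCB := Ne.symm hBC
  have hw' := hw.h3_swap
  have key : evalSemi v (x ++ [A, B] ++ y ++ [A, C] ++ z ++ [B, C] ++ t) U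
      = evalSemi v (x ++ [B, A] ++ y ++ [C, A] ++ z ++ [C, B] ++ t) U := by
    refine evalSemi_congr fun T hT => ?_
    have hAT : A ∉ T := fun e => hAU (hT e)
    have hBT : B ∉ T := fun e => hBU (hT e)
    have hCT : C ∉ T := fun e => hCU (hT e)
    have hm := Move.H3 (drop T x) (drop T y) (drop T z) (drop T t) A B C
    have hg := hw.drop T
    have hg' := hw'.drop T
    simp [hAT, hBT, hCT] at hm hg hg' ⊢
    exact evalWord_move hg hg' hm
  simp only [List.mem_append, not_or] at hA hB hC
  have hABU : A ∉ insert B U := by simp [hAB, hAU]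
  have hACU : A ∉ insert C U := by simp [hAC, hAU]
  have hBCU : B ∉ insert C U := by simp [hBC, hBU]
  have hABCU : A ∉ insert B (insert C U) := by simp [hAB, hAC, hAU]
  have eABC : (x ++ [A, B] ++ y ++ [A, C] ++ z ++ [B, C] ++ t).toFinset
      = insert A (insert B (insert C U)) := toFinset_h3 ..
  have eABC' : (x ++ [B, A] ++ y ++ [C, A] ++ z ++ [C, B] ++ t).toFinset
      = insert A (insert B (insert C U)) := by
    rw [← eABC]
    exact List.toFinset_eq_of_perm _ _ (List.perm_iff_count.2 fun a => by
      simp [List.count_cons]; omega)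
  have eAB : (x ++ [A, B] ++ y ++ [A] ++ z ++ [B] ++ t).toFinset = insert A (insert B U) := by
    rw [List.toFinset_eq_of_perm _ (A :: A :: B :: B :: (x ++ y ++ z ++ t))
      (List.perm_iff_count.2 fun a => by simp [List.count_cons]; omega)]
    simp [hU]
  have eAB' : (x ++ [B, A] ++ y ++ [A] ++ z ++ [B] ++ t).toFinset = insert A (insert B U) := by
    rw [List.toFinset_eq_of_perm _ (A :: A :: B :: B :: (x ++ y ++ z ++ t))
      (List.perm_iff_count.2 fun a => by simp [List.count_cons]; omega)]
    simp [hU]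
  have eAC : (x ++ [A] ++ y ++ [A, C] ++ z ++ [C] ++ t).toFinset = insert A (insert C U) := by
    rw [List.toFinset_eq_of_perm _ (A :: A :: C :: C :: (x ++ y ++ z ++ t))
      (List.perm_iff_count.2 fun a => by simp [List.count_cons]; omega)]
    simp [hU]
  have eAC' : (x ++ [A] ++ y ++ [C, A] ++ z ++ [C] ++ t).toFinset = insert A (insert C U) := by
    rw [List.toFinset_eq_of_perm _ (A :: A :: C :: C :: (x ++ y ++ z ++ t))
      (List.perm_iff_count.2 fun a => by simp [List.count_cons]; omega)]
    simp [hU]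
  have eBC : (x ++ [B] ++ y ++ [C] ++ z ++ [B, C] ++ t).toFinset = insert B (insert C U) := by
    rw [List.toFinset_eq_of_perm _ (B :: B :: C :: C :: (x ++ y ++ z ++ t))
      (List.perm_iff_count.2 fun a => by simp [List.count_cons]; omega)]
    simp [hU]
  have eBC' : (x ++ [B] ++ y ++ [C] ++ z ++ [C, B] ++ t).toFinset = insert B (insert C U) := by
    rw [List.toFinset_eq_of_perm _ (B :: B :: C :: C :: (x ++ y ++ z ++ t))
      (List.perm_iff_count.2 fun a => by simp [List.count_cons]; omega)]
    simp [hU]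
  have gAB := hw.drop {C}
  have gAC := hw.drop {B}
  have gBC := hw.drop {A}
  have gAB' := hw'.drop {C}
  have gAC' := hw'.drop {B}
  have gBC' := hw'.drop {A}
  simp [drop_singleton_of_notMem, hA, hB, hC, hAB, hAC, hBC, hBA, hCA, hCB]
    at gAB gAC gBC gAB' gAC' gBC'
  rw [symbol_of_isGauss hw, symbol_of_isGauss hw',
    symbol_of_isGauss (w := x ++ [A, B] ++ y ++ [A] ++ z ++ [B] ++ t) (by simpa using gAB),
    symbol_of_isGauss (w := x ++ [A] ++ y ++ [A, C] ++ z ++ [C] ++ t) (by simpa using gAC),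
    symbol_of_isGauss (w := x ++ [B] ++ y ++ [C] ++ z ++ [B, C] ++ t) (by simpa using gBC),
    symbol_of_isGauss (w := x ++ [B, A] ++ y ++ [A] ++ z ++ [B] ++ t) (by simpa using gAB'),
    symbol_of_isGauss (w := x ++ [A] ++ y ++ [C, A] ++ z ++ [C] ++ t) (by simpa using gAC'),
    symbol_of_isGauss (w := x ++ [B] ++ y ++ [C] ++ z ++ [C, B] ++ t) (by simpa using gBC'),
    eABC, eABC', eAB, eAB', eAC, eAC', eBC, eBC']
  simp only [evalSemi_insert hABCU, evalSemi_insert hABU, evalSemi_insert hACU,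
    evalSemi_insert hBCU, evalSemi_insert hBU, evalSemi_insert hCU, key]
  simp [drop_singleton_of_notMem, hA, hB, hC, hAB, hAC, hBC, hBA, hCA, hCB]
  abel

theorem isWeight_symbol (hv : HasDegreeLE v 5) (h0 : v (cls emptyWord) = 0) :
    IsWeight (symbol v) where
  iso := symbol_iso
  nil := by
    refine (symbol_eq emptyWord).trans ?_
    change v (semiWord emptyWord ∅) = 0
    rw [semiWord_empty, h0]
  length {w} hl := by
    by_cases h : IsGauss w
    · have := h.length_eq
      exact (symbol_eq ⟨w, h⟩).trans (hv _ _ subset_rfl (by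
        change 5 < w.toFinset.card
        omega))
    · exact if_neg h
  h1 _ _ _ := symbol_h1
  h2 _ _ _ _ _ := symbol_h2
  h3 _ _ _ _ _ _ _ := symbol_h3

/-- An invariant whose symbol vanishes is zero. -/
theorem eq_zero_of_symbol (h : ∀ w, IsGauss w → symbol v w = 0) : v = 0 := by
  have key : ∀ (n : ℕ) (w : GaussWord), w.letters.card = n → v (cls w) = 0 := by
    intro n
    induction n using Nat.strong_induction_on with
    | _ n ih =>
    intro w hn
    have hs := (symbol_eq w).symm.trans (h w.1 w.2)
    -- All terms of the expansion other than `w` itself have smaller rank, so `v` vanishes on them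
    -- by induction.
    rw [semiWord, map_sum, Finset.sum_eq_single_of_mem ∅ (Finset.empty_mem_powerset _)] at hs
    · have e : w.delete ∅ = w := Subtype.ext (by simp [GaussWord.delete])
      simpa [e] using hs
    · intro T hT hne
      have hl : (w.delete T).letters = w.letters \ T := toFinset_drop
      have hlt : (w.letters \ T).card < n := by
        rw [← hn]
        refine Finset.card_lt_card (Finset.sdiff_ssubset (Finset.mem_powerset.1 hT) ?_)
        exact Finset.nonempty_iff_ne_empty.2 hne
      rw [map_zsmul, ih _ hlt _ (by rw [hl]), smul_zero]
  refine FreeAbelianGroup.lift_ext _ _ fun p => ?_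
  induction p using Quotient.inductionOn with
  | h w => exact key _ w rfl

end

/-! ### Weight systems with values in a group of exponent two -/

/-- Whether `a`, `b` appear next to each other, in this order. -/
def hasPair (a b : ℕ) : List ℕ → Bool
  | [] => false
  | c :: l => match l with
    | [] => false
    | d :: _ => (Nat.beq c a && Nat.beq d b) || hasPair a b l

theorem exists_of_hasPair {a b : ℕ} : ∀ {l : List ℕ}, hasPair a b l = true →
    ∃ y z, l = y ++ [a, b] ++ z
  | [], h => by simp [hasPair] at h
  | [c], h => by simp [hasPair] at h
  | c :: d :: l, h => by
    rw [hasPair, Bool.or_eq_true, Bool.and_eq_true] at h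
    rcases h with ⟨h₁, h₂⟩ | h
    · exact ⟨[], l, by simp [Nat.eq_of_beq_eq_true h₁, Nat.eq_of_beq_eq_true h₂]⟩
    · obtain ⟨y, z, e⟩ := exists_of_hasPair h
      exact ⟨c :: y, z, by rw [e]; simp⟩

/-- Whether a word has the form `xAAy` or `xAByBAz`. -/
def hasBigon : List ℕ → Bool
  | [] => false
  | a :: l => match l with
    | [] => false
    | b :: l' => Nat.beq a b || hasPair b a l' || hasBigon l

theorem exists_of_hasBigon : ∀ {l : List ℕ}, hasBigon l = true →
    (∃ x y A, l = x ++ [A, A] ++ y) ∨ ∃ x y z A B, l = x ++ [A, B] ++ y ++ [B, A] ++ z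
  | [], h => by simp [hasBigon] at h
  | [c], h => by simp [hasBigon] at h
  | a :: b :: l, h => by
    rw [hasBigon, Bool.or_eq_true, Bool.or_eq_true] at h
    rcases h with (h | h) | h
    · exact Or.inl ⟨[], l, a, by simp [Nat.eq_of_beq_eq_true h]⟩
    · obtain ⟨y, z, e⟩ := exists_of_hasPair h
      exact Or.inr ⟨[], y, z, a, b, by simp [e]⟩
    · rcases exists_of_hasBigon h with ⟨x, y, A, e⟩ | ⟨x, y, z, A, B, e⟩
      · exact Or.inl ⟨a :: x, y, A, by rw [e]; simp⟩
      · exact Or.inr ⟨a :: x, y, z, A, B, by rw [e]; simp⟩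

/-- Membership in a list of numbers. -/
def memCode (c : ℕ) : List ℕ → Bool
  | [] => false
  | d :: l => cond (Nat.beq c d) true (memCode c l)

theorem mem_of_memCode {c : ℕ} : ∀ {l : List ℕ}, memCode c l = true → c ∈ l
  | d :: l, h => by
    cases hb : Nat.beq c d with
    | true => simp [Nat.eq_of_beq_eq_true hb]
    | false =>
      rw [memCode, hb, cond_false] at h
      exact List.mem_cons_of_mem _ (mem_of_memCode h)

/-- Adds a number to a list, cancelling equal numbers. -/
def toggle (c : ℕ) : List ℕ → List ℕ
  | [] => [c]
  | d :: l => cond (Nat.beq c d) l (d :: toggle c l)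

/-- Whether a weight system of exponent two vanishes on a word (given in pieces) because it has
more than five letters, or contains a bigon, or has its code in `K`. -/
noncomputable def isZero (K : List ℕ) (ps : List (List ℕ)) : Bool :=
  Nat.ble (Nat.pow 16 10) (scanCode ps) || hasBigon ps.flatten || memCode (scanCode ps) K

/-- The codes of the words in a list that are not known to be annihilated. -/
noncomputable def unknowns (K : List ℕ) : List (List (List ℕ)) → List ℕ
  | [] => []
  | ps :: l => cond (isZero K ps) (unknowns K l) (toggle (scanCode ps) (unknowns K l))

/-- The words in the third relation. -/
def h3Words (s : List ℕ × List ℕ × List ℕ × List ℕ) : List (List (List ℕ)) :=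
  match s with
  | (x, y, z, t) =>
    [[x, [10, 11], y, [10, 12], z, [11, 12], t], [x, [10, 11], y, [10], z, [11], t],
     [x, [10], y, [10, 12], z, [12], t], [x, [11], y, [12], z, [11, 12], t],
     [x, [11, 10], y, [12, 10], z, [12, 11], t], [x, [11, 10], y, [10], z, [11], t],
     [x, [10], y, [12, 10], z, [12], t], [x, [11], y, [12], z, [12, 11], t]]

/-- Uses instances of the third relation with a single unknown word to extend the list `K` of the
codes of annihilated words. -/
noncomputable def propagate :
    List (List ℕ × List ℕ × List ℕ × List ℕ) → List ℕ → List ℕ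
  | [], K => K
  | s :: l, K => match unknowns K (h3Words s) with
    | [c] => propagate l (c :: K)
    | _ => propagate l K

open Letter in
/-- Words on which a weight system of exponent two is determined by its values. -/
def basisWords : List (List ℕ) :=
  [[A, B, C, D, E, D, B, E, C, A], [A, B, C, D, E, A, C, E, B, D], [A, B, C, D, B, E, A, C, E, D],
   [A, B, C, B, D, E, A, E, C, D], [A, B, C, D, E, C, E, A, D, B], [A, B, C, D, E, D, B, E, A, C],
   [A, B, C, D, C, A, D, B]]

/-- Instances of the third relation which, taken in this order, determine a weight system of
exponent two from its values on the basis words. -/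
def steps : List (List ℕ × List ℕ × List ℕ × List ℕ) :=
  [([], [], [0,1,0,1,2], [2]), ([0], [], [1,0,1,2], [2]), ([0,1], [], [0,1,2], [2]),
   ([0,1,0], [], [1,2], [2]), ([0,1,0,1], [], [2], [2]), ([0,1,0,1], [2], [2], []),
   ([0,1,0,1,2], [], [], [2]), ([], [], [0,1], [1,2,0,2]), ([0], [], [1], [1,2,0,2]),
   ([0], [1], [1], [2,0,2]), ([0,1], [], [], [1,2,0,2]), ([0,1], [], [1,2], [0,2]),
   ([0,1], [], [1,2,0], [2]), ([0,1], [], [1,2,0,2], []), ([0,1], [], [1,2], [2,0]),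
   ([], [], [0], [0,1,2,1,2]), ([], [0], [0], [1,2,1,2]), ([0], [], [], [0,1,2,1,2]),
   ([0], [], [0,1], [2,1,2]), ([0], [], [0,1,2], [1,2]), ([0], [], [0,1,2,1], [2]),
   ([0], [], [0,1,2,1,2], []), ([], [], [0], [1,0,2,1,2]), ([], [], [0,1], [0,2,1,2]),
   ([], [], [0,1,0], [2,1,2]), ([], [], [0,1,0,2], [1,2]), ([], [], [0,1,0,2,1], [2]),
   ([], [], [0,1,0,2,1,2], []), ([0], [], [], [1,0,2,1,2]), ([0], [], [1], [0,2,1,2]),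
   ([0], [], [1,0,2], [1,2]), ([0], [], [1,0,2,1], [2]), ([0], [], [1,0,2,1,2], []),
   ([0,1], [], [], [0,2,1,2]), ([0,1], [], [0], [2,1,2]), ([0,1], [], [0,2], [1,2]),
   ([0,1], [], [0,2,1,2], []), ([0,1,0], [], [], [2,1,2]), ([0,1,0], [], [2], [1,2]),
   ([0,1,0], [], [2,1], [2]), ([0,1,0], [], [2,1,2], []), ([0,1,0,2], [], [], [1,2]),
   ([0,1,0,2], [], [1], [2]), ([0,1,0,2,1], [], [], [2]), ([0,1,0,2,1], [], [2], []),
   ([], [], [0], [1,2,0,1,2]), ([], [], [0,1,2], [0,1,2]), ([], [], [0,1,2,0], [1,2]),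
   ([], [], [0,1,2,0,1], [2]), ([], [], [0,1,2,0,1,2], []), ([], [0,1,2,0], [1,2], []),
   ([0], [], [], [1,2,0,1,2]), ([0], [], [1], [2,0,1,2]), ([0], [], [1,2], [0,1,2]),
   ([0], [], [1,2,0,1], [2]), ([0], [], [1,2,0,1,2], []), ([0], [1], [2,0], [1,2]),
   ([0], [1,2], [0,1], [2]), ([0,1], [], [2,0], [1,2]), ([0,1], [], [2,0,1,2], []),
   ([0,1,2], [], [], [0,1,2]), ([0,1,2], [], [0,1], [2]), ([0,1,2], [0,1], [2], []),
   ([0,1,2,0], [], [1], [2]), ([0,1,2,0,1], [], [], [2]), ([], [], [0], [1,2,1,0,2]),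
   ([], [], [0,1,2,1], [0,2]), ([], [0], [1,2,1], [0,2]), ([0], [], [], [1,2,1,0,2]),
   ([0], [], [1], [2,1,0,2]), ([0], [], [1,2], [1,0,2]), ([0], [], [1,2,1], [0,2]),
   ([0], [], [1,2,1,0,2], []), ([0], [1], [2,1], [0,2]), ([0,1,2], [], [1], [0,2]),
   ([0,1,2,1], [], [], [0,2]), ([0,1,2,1], [], [0], [2]), ([0,1,2,1], [], [0,2], []),
   ([], [], [0,1], [2,1,2,0]), ([], [], [0,1,2,1], [2,0]), ([], [], [0,1,2,1,2,0], []),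
   ([], [0], [1,2,1,2], [0]), ([0], [], [], [1,2,1,2,0]), ([0], [], [1], [2,1,2,0]),
   ([0], [], [1,2], [1,2,0]), ([0], [], [1,2,1], [2,0]), ([0], [], [1,2,1,2], [0]),
   ([0], [1,2], [1,2,0], []), ([0], [1,2,1,2], [0], []), ([0,1], [], [], [2,1,2,0]),
   ([0,1], [], [2], [1,2,0]), ([0,1], [], [2,1,2], [0]), ([0,1], [], [2,1,2,0], []),
   ([0,1], [2], [1], [2,0]), ([0,1,2], [], [1], [2,0]), ([0,1,2,1], [], [], [2,0]),
   ([0,1,2,1], [], [2], [0]), ([0,1,2,1], [], [2,0], []), ([], [], [0,1,0,2], [2,1]),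
   ([0], [], [1,0,2], [2,1]), ([0,1], [], [0,2], [2,1]), ([0,1,0], [], [2], [2,1]),
   ([0,1,0], [2], [2], [1]), ([0,1,0,2], [], [2,1], []), ([], [], [0,1,2,0,2], [1]),
   ([0], [], [1], [2,0,2,1]), ([0], [], [1,2,0,2], [1]), ([0], [1], [2,0,2], [1]),
   ([0,1], [], [2,0], [2,1]), ([0,1], [], [2,0,2], [1]), ([0,1], [2], [0,2], [1]),
   ([0,1], [2,0], [2], [1]), ([0,1], [2,0,2], [1], []), ([0,1,2,0], [], [2], [1]),
   ([0,1,2,0,2], [], [], [1]), ([0,1,2,0,2], [], [1], []), ([0], [], [1,2], [2,0,1]),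
   ([], [], [], [0,1,0,1]), ([], [], [0,1], [0,1]), ([], [], [0,1,0,1], []),
   ([0], [], [], [1,0,1]), ([0], [], [1], [0,1]), ([0], [], [1,0], [1]), ([0], [1], [], [0,1]),
   ([0], [1,0], [], [1]), ([0,1], [], [0], [1]), ([0,1,0], [], [], [1]),
   ([], [0,1,2,0], [1], [2]), ([0], [1], [2,0,1,2], []), ([0,1], [2], [0], [1,2]),
   ([0,1], [2,0], [1], [2]), ([], [0,1,2], [1], [0,2]), ([0], [1], [2,1], [2,0]),
   ([0], [1,2,1], [2], [0]), ([0,1], [2,1], [2], [0]), ([0], [1], [2,0], [2,1]),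
   ([0], [1], [2,0,2,1], []), ([0,1], [2], [0], [2,1]), ([0], [1,2], [2,0,1], []),
   ([0,1], [2], [2,0], [1]), ([0], [1], [2], [2,1,0]), ([0], [1,2], [2], [1,0]),
   ([], [0,1], [0,1], []), ([0], [], [1,0,1], []), ([0], [1], [0,1], []), ([0], [], [1], [1,0]),
   ([0], [1], [1], [0]), ([], [0,1], [0,2,1,2], []), ([], [0,1,0,2], [1,2], []),
   ([0], [1], [0,2,1], [2]), ([0], [1,0], [2,1,2], []), ([0], [1], [2], [0,1,2]),
   ([], [0,1], [2,1], [0,2]), ([0], [1], [2,1,0,2], []), ([0], [1,2], [1,0,2], []),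
   ([0,1,2], [1], [0], [2]), ([0,1,2], [1], [0,2], []), ([], [0,1], [2,1], [2,0]),
   ([], [0,1,2], [1], [2,0]), ([], [0,1,2,1], [2], [0]), ([0], [1], [2], [1,2,0]),
   ([0], [1,2,1], [2,0], []), ([0,1,2], [1], [2], [0]), ([], [0,1], [0,2], [2,1]),
   ([0], [1,0], [2], [2,1]), ([0,1], [0,2], [2,1], []), ([], [0,1], [2,0], [2,1]),
   ([], [0,1,2,0], [2], [1]), ([0], [1], [2], [0,2,1]), ([0,1], [2,0], [2,1], []),
   ([0,1,2], [0], [2], [1]), ([0,1,2], [0,2], [1], []), ([], [0,1,2], [2,0], [1]),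
   ([0], [1], [2], [2,0,1]), ([0], [], [], [0]), ([0], [], [0], []), ([], [0,1,0], [1], []),
   ([0], [1,0,1], [], []), ([0], [1,0], [1,2], [2]), ([], [0,1], [1,2,0], [2]),
   ([], [0,1], [1,2,0,2], []), ([0], [1], [1,2], [0,2]), ([0], [1], [1,2,0], [2]),
   ([0], [1], [1,2,0,2], []), ([0,1], [1], [2], [0,2]), ([], [0,1], [1,2], [2,0]),
   ([0], [1], [1,2], [2,0]), ([0], [0,1], [2,1], [2]), ([], [0], [1,0,2], [1,2]),
   ([], [0], [1,0,2,1,2], []), ([], [0,1,0,2,1], [2], []), ([0], [1], [0], [2,1,2]),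
   ([0], [1], [0,2,1,2], []), ([0], [1,0], [2], [1,2]), ([0,1], [0], [2], [1,2]),
   ([0,1], [0], [2,1,2], []), ([0,1,0], [2,1], [2], []), ([0,1,2,0], [1], [2], []),
   ([], [0], [1,2,1,0], [2]), ([], [0,1,2,1], [0], [2]), ([], [0,1,2,1], [0,2], []),
   ([0,1,2,1], [0], [2], []), ([], [0], [1], [2,1,2,0]), ([], [0], [1,2,1], [2,0]),
   ([0], [1], [2,1,2,0], []), ([0], [0,1], [2], [2,1]), ([], [0], [1,0,2], [2,1]),
   ([], [0], [1], [2,0,2,1]), ([], [0,1,2,0,2], [1], []), ([0,1,2,0], [2], [1], []),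
   ([], [0], [1,2], [2,0,1]), ([0,1,2], [2,0], [1], []), ([], [], [0], [0]), ([], [0], [0], []),
   ([], [], [0], [1,0,1]), ([], [], [0,1,0], [1]), ([], [0], [1], [0,1]), ([0], [1], [0], [1]),
   ([0], [1,0], [1], []), ([0,1,0], [], [1], []), ([], [0], [1], [1,0]), ([], [0,1], [1], [0]),
   ([], [0], [1,0,1,2], [2]), ([], [0,1,0], [1,2], [2]), ([0], [1,0,1], [2], [2]),
   ([], [0], [0,1], [2,1,2]), ([], [0], [0,1,2,1], [2]), ([0], [0], [1], [2,1,2]),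
   ([0], [0,1,2,1], [2], []), ([], [], [], []), ([0], [0,1], [1], []), ([0,1], [0], [1], [])]

theorem steps_valid : ∀ s ∈ steps, ∀ ps ∈ h3Words s,
    IsGauss ps.flatten ∧ ps.flatten.length ≤ 15 ∧ ∀ a ∈ ps.flatten, a < 16 := by
  unfold IsGauss
  decide +kernel

/-- This computation shows that, modulo 2, the seven words determine a weight system. The entry 0 is
the code of the empty word. -/
theorem check_steps : (List.range 6).all (fun r => allGauss r fun u =>
    isZero (propagate steps (0 :: basisWords.map code)) [u]) = true := by
  decide +kernel

/-! ### Soundness of the elimination modulo 2 -/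

theorem pack_lt {l : List ℕ} (h : ∀ a ∈ l, a < 15) : pack l < 16 ^ l.length := by
  induction l with
  | nil => simp [pack]
  | cons a l ih =>
    have := ih fun b hb => h b (by simp [hb])
    have := h a (by simp)
    simp only [pack, List.length_cons, pow_succ]
    omega

/-- A word of length `ℓ` has code below `16 ^ ℓ`. This justifies the comparison with `16 ^ 10` in
`isZero` as a test for rank above 5. -/
theorem lt_length_of_le_code {w : List ℕ} (hw : w.length ≤ 15) {n : ℕ} (h : 16 ^ n ≤ code w) :
    n < w.length := by
  by_contra hn
  rw [code_eq_pack_pattern] at h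
  have h₁ : pack (pattern w) < 16 ^ (pattern w).length := pack_lt fun a ha => by
    obtain ⟨b, hb, rfl⟩ := List.mem_map.1 ha
    exact (List.idxOf_lt_length_of_mem hb).trans_le hw
  have h₂ : (pattern w).length = w.length := by simp [pattern]
  have h₃ : 16 ^ w.length ≤ 16 ^ n := Nat.pow_le_pow_right (by norm_num) (not_lt.1 hn)
  rw [h₂] at h₁
  omega

section

variable {M : Type*} [AddCommGroup M] {δ : List ℕ → M}

/-- The codes in `K` belong to words on which `δ` vanishes. -/
def Annihilated (δ : List ℕ → M) (K : List ℕ) : Prop :=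
  ∀ c ∈ K, ∀ w : List ℕ, w.length ≤ 15 → code w = c → δ w = 0

open Classical in
/-- The value of a weight system on the words of a given code. -/
noncomputable def codeValue (δ : List ℕ → M) (c : ℕ) : M :=
  if h : ∃ w : List ℕ, w.length ≤ 15 ∧ code w = c then δ h.choose else 0

theorem codeValue_code (h : IsWeight δ) {w : List ℕ} (hw : w.length ≤ 15) :
    codeValue δ (code w) = δ w := by
  have hex : ∃ u : List ℕ, u.length ≤ 15 ∧ code u = code w := ⟨w, hw, rfl⟩
  rw [codeValue, dif_pos hex]
  exact h.iso (wordIso_of_code_eq hex.choose_spec.1 hw hex.choose_spec.2)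

theorem codeValue_add_self (h2 : ∀ w, δ w + δ w = 0) (c : ℕ) :
    codeValue δ c + codeValue δ c = 0 := by
  rw [codeValue]
  split_ifs
  · exact h2 _
  · exact add_zero 0

/-- The two shorter words in the second relation are isomorphic, so their values cancel in exponent
two. -/
theorem eq_zero_of_hasBigon (h : IsWeight δ) (h2 : ∀ w, δ w + δ w = 0) {w : List ℕ}
    (hw : IsGauss w) (hb : hasBigon w = true) : δ w = 0 := by
  rcases exists_of_hasBigon hb with ⟨x, y, A, rfl⟩ | ⟨x, y, z, A, B, rfl⟩
  · exact h.h1 x y A hw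
  · have e := h.h2 x y z A B hw
    obtain ⟨-, -, hA, hB⟩ := hw.of_h2
    rwa [← h.iso (wordIso_replace hA hB), add_assoc, h2, add_zero] at e

theorem eq_zero_of_isZero (h : IsWeight δ) (h2 : ∀ w, δ w + δ w = 0) {K : List ℕ}
    (hK : Annihilated δ K) {ps : List (List ℕ)} (hg : IsGauss ps.flatten)
    (hl : ps.flatten.length ≤ 15) (ha : ∀ a ∈ ps.flatten, a < 16) (hz : isZero K ps = true) :
    δ ps.flatten = 0 := by
  rw [isZero, scanCode_eq_code ps ha hl, Bool.or_eq_true, Bool.or_eq_true] at hz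
  rcases hz with (hz | hz) | hz
  · exact h.length (lt_length_of_le_code hl (Nat.le_of_ble_eq_true hz))
  · exact eq_zero_of_hasBigon h h2 hg hz
  · exact hK _ (mem_of_memCode hz) _ hl rfl

theorem sum_toggle {g : ℕ → M} (h2 : ∀ c, g c + g c = 0) (c : ℕ) :
    ∀ l : List ℕ, ((toggle c l).map g).sum = g c + (l.map g).sum
  | [] => by simp [toggle]
  | d :: l => by
    cases hb : Nat.beq c d with
    | true => simp [toggle, Nat.eq_of_beq_eq_true hb, ← add_assoc, h2]
    | false => simp [toggle, hb, sum_toggle h2 c l, add_left_comm]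

/-- Only zero terms and pairs of equal terms are discarded, neither of which affects a sum in
exponent two. -/
theorem sum_unknowns (h : IsWeight δ) (h2 : ∀ w, δ w + δ w = 0) {K : List ℕ}
    (hK : Annihilated δ K) : ∀ l : List (List (List ℕ)), (∀ ps ∈ l,
      IsGauss ps.flatten ∧ ps.flatten.length ≤ 15 ∧ ∀ a ∈ ps.flatten, a < 16) →
    ((unknowns K l).map (codeValue δ)).sum = (l.map fun ps => δ ps.flatten).sum
  | [], _ => rfl
  | ps :: l, hl => by
    obtain ⟨hg, hlen, ha⟩ := hl ps (by simp)
    have ih := sum_unknowns h h2 hK l fun qs hqs => hl qs (by simp [hqs])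
    rw [unknowns, List.map_cons, List.sum_cons, ← ih]
    cases hz : isZero K ps with
    | true => rw [cond_true, eq_zero_of_isZero h h2 hK hg hlen ha hz, zero_add]
    | false =>
      rw [cond_false, sum_toggle (codeValue_add_self h2), scanCode_eq_code ps ha hlen, codeValue_code h hlen]

/-- Without signs the third relation says that eight values add up to zero. If all but one are zero
or cancel in pairs, the last one is zero too. -/
theorem annihilated_propagate (h : IsWeight δ) (h2 : ∀ w, δ w + δ w = 0) :
    ∀ (l : List (List ℕ × List ℕ × List ℕ × List ℕ)) (K : List ℕ), (∀ s ∈ l, ∀ ps ∈ h3Words s,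
      IsGauss ps.flatten ∧ ps.flatten.length ≤ 15 ∧ ∀ a ∈ ps.flatten, a < 16) →
    Annihilated δ K → Annihilated δ (propagate l K)
  | [], K, _, hK => hK
  | (x, y, z, t) :: l, K, hl, hK => by
    have ih := fun K => annihilated_propagate h h2 l K fun s hs => hl s (by simp [hs])
    have hv := hl (x, y, z, t) (by simp)
    have hsum := sum_unknowns h h2 hK _ hv
    have hW := (hv [x, [10, 11], y, [10, 12], z, [11, 12], t] (by simp [h3Words])).1
    have hrel := h.h3 x y z t 10 11 12 (by simpa using hW)
    rw [← sub_eq_zero] at hrel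
    have hneg : ∀ w, -δ w = δ w := fun w => neg_eq_of_add_eq_zero_left (h2 w)
    have hzero : ((h3Words (x, y, z, t)).map fun ps => δ ps.flatten).sum = 0 := by
      rw [← hrel, sub_eq_add_neg, neg_add, neg_add, neg_add, hneg, hneg, hneg, hneg]
      simp [h3Words, add_assoc]
    rw [propagate]
    split
    · next c hc =>
      refine ih _ fun d hd w hw hcode => ?_
      rcases List.mem_cons.1 hd with rfl | hd
      · rw [hc, hzero, List.map_cons, List.map_nil, List.sum_singleton, ← hcode,
          codeValue_code h hw] at hsum
        exact hsum
      · exact hK d hd w hw hcode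
    · exact ih _ hK

/-- A weight system with values of exponent two that vanishes on the basis words is zero. -/
theorem IsWeight.eq_zero_of_basisWords (h : IsWeight δ) (h2 : ∀ w, δ w + δ w = 0)
    (hb : ∀ b ∈ basisWords, δ b = 0) {w : List ℕ} (hw : IsGauss w) : δ w = 0 := by
  by_cases hl : 10 < w.length
  · exact h.length hl
  have hK : Annihilated δ (0 :: basisWords.map code) := by
    intro c hc w hw hcode
    rcases List.mem_cons.1 hc with rfl | hc
    · have e := h.iso (wordIso_of_code_eq (v := []) (by simp) hw hcode.symm)
      rw [← e, h.nil]
    · obtain ⟨b, hbm, rfl⟩ := List.mem_map.1 hc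
      have hbl : ∀ b ∈ basisWords, b.length ≤ 15 := by decide
      rw [h.iso (wordIso_of_code_eq hw (hbl b hbm) hcode), hb b hbm]
  obtain ⟨r, hr⟩ := hw.exists_length_eq
  obtain ⟨u, f, rfl, hf, hlt, hP⟩ := of_allGauss
    (List.all_eq_true.1 check_steps r (List.mem_range.2 (by omega))) w hw hr
  have hiso := wordIso_map hf
  rw [← h.iso hiso]
  rw [List.length_map] at hl hr
  have := eq_zero_of_isZero h h2 (annihilated_propagate h h2 steps _ steps_valid hK) (ps := [u])
    (by simpa using hiso.symm.isGauss hw) (by simp; omega)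
    (fun a ha => (hlt a (by simpa using ha)).trans (by omega)) hP
  simpa using this

end

/-! ### Torsion -/

/-- Run a fresh letter `B` parallel to the first letter `A`, as `AB…BA`. The two shorter words in
the second relation are then both isomorphic to `w`, so `2 δ(w)` is minus the value on a word of one
rank more. Iteration reaches rank above 5. -/
theorem IsWeight.two_pow_smul {M : Type*} [AddCommGroup M] {δ : List ℕ → M} (h : IsWeight δ)
    (k : ℕ) : ∀ {w : List ℕ}, IsGauss w → 10 < w.length + 2 * k → 2 ^ k • δ w = 0 := by
  induction k with
  | zero => intro w _ hl; rw [h.length (by omega), smul_zero]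
  | succ k ih =>
    intro w hw hl
    cases w with
    | nil => rw [h.nil, smul_zero]
    | cons A v =>
      obtain ⟨B, hB⟩ := Infinite.exists_notMem_finset (A :: v).toFinset
      rw [List.mem_toFinset] at hB
      have hW' := hw.cons_cons hB
      obtain ⟨x, y, rfl, -, -⟩ := hw.exists_of_cons
      have hW : IsGauss ([] ++ [A, B] ++ x ++ [B, A] ++ y) :=
        hW'.of_perm (List.perm_iff_count.2 fun a => by simp [List.count_cons]; omega)
      obtain ⟨-, -, hA', hB'⟩ := hW.of_h2
      have e := h.h2 [] x y A B hW
      rw [← h.iso (wordIso_replace hA' hB'), add_assoc, ← two_smul ℕ] at e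
      have hz := ih hW (by simp at hl ⊢; omega)
      have e' : δ (A :: (x ++ A :: y)) = δ ([] ++ [A] ++ x ++ [A] ++ y) := by simp
      rw [pow_succ, mul_smul, e', ← neg_eq_of_add_eq_zero_right e, smul_neg, hz, neg_zero]

theorem basisWords_isGauss : ∀ b ∈ basisWords, IsGauss b := by
  unfold IsGauss
  decide

/-- An invariant of degree at most 5 whose symbol vanishes on the basis words is zero. -/
theorem eq_zero_of_symbol_basisWords {H : Type*} [AddCommGroup H] {v : ZP →+ H}
    (hv : HasDegreeLE v 5) (h0 : v (cls emptyWord) = 0)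
    (hb : ∀ b ∈ basisWords, symbol v b = 0) : v = 0 := by
  have h := isWeight_symbol hv h0
  let D : AddSubgroup H := AddSubgroup.closure (Set.range (symbol v))
  -- `E` is `2D`. All values lie in `D`, so modulo `E` they have exponent two and the elimination
  -- applies.
  let E : AddSubgroup H := D.map (nsmulAddMonoidHom 2)
  have hmem : ∀ w, symbol v w ∈ D := fun w => AddSubgroup.subset_closure ⟨w, rfl⟩
  have hq := h.map (QuotientAddGroup.mk' E)
  have hE : ∀ w, symbol v w ∈ E := by
    intro w
    by_cases hw : IsGauss w
    · refine (QuotientAddGroup.eq_zero_iff _).1 (hq.eq_zero_of_basisWords ?_ ?_ hw)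
      · intro w
        rw [← map_add, QuotientAddGroup.mk'_apply, QuotientAddGroup.eq_zero_iff]
        exact ⟨symbol v w, hmem w, two_smul ℕ _⟩
      · intro b hbm
        simp only [hb b hbm, map_zero]
    · rw [symbol, if_neg hw]
      exact E.zero_mem
  -- `D = 2D` makes `D` divisible by every power of 2, which is incompatible with bounded 2-power
  -- exponent unless `D = 0`.
  have hDE : D ≤ E := (AddSubgroup.closure_le _).2 (by rintro _ ⟨w, rfl⟩; exact hE w)
  have hdiv : ∀ k : ℕ, ∀ d ∈ D, ∃ e ∈ D, 2 ^ k • e = d := by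
    intro k
    induction k with
    | zero => exact fun d hd => ⟨d, hd, by simp⟩
    | succ k ih =>
      intro d hd
      obtain ⟨e, he, rfl⟩ := ih d hd
      obtain ⟨e', he', rfl⟩ := hDE he
      exact ⟨e', he', by rw [pow_succ, mul_smul]; rfl⟩
  -- The exponent 6 satisfies `10 < w.length + 2 * 6` for every word, the empty one included.
  have htors : D ≤ (nsmulAddMonoidHom (2 ^ 6) : H →+ H).ker := (AddSubgroup.closure_le _).2 (by
    rintro _ ⟨w, rfl⟩
    by_cases hw : IsGauss w
    · exact h.two_pow_smul 6 hw (by omega)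
    · rw [symbol, if_neg hw]
      exact AddSubgroup.zero_mem _)
  refine eq_zero_of_symbol fun w _ => ?_
  obtain ⟨e, he, hew⟩ := hdiv 6 _ (hmem w)
  rw [← hew]
  exact htors he

/-! ### Universality -/

/-- Integer coefficients allow `f` to be evaluated without choosing representatives of residues. -/
theorem exists_addMonoidHom_target {H : Type*} [AddCommGroup H] (h : Fin 6 → H) (g : H)
    (hh : ∀ i, 2 • h i = 0) (hg : 4 • g = 0) : ∃ f : Target →+ H, ∀ (c : Fin 6 → ℤ) (d : ℤ),
      f (fun i => (c i : ZMod 2), (d : ZMod 4)) = ∑ i, c i • h i + d • g := by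
  let l : Fin 6 → ZMod 2 →+ H := fun i => ZMod.lift 2 ⟨zmultiplesHom H (h i), by
    simpa [← natCast_zsmul] using hh i⟩
  let m : ZMod 4 →+ H := ZMod.lift 4 ⟨zmultiplesHom H g, by
    simpa [← natCast_zsmul] using hg⟩
  refine ⟨AddMonoidHom.coprod (∑ i, (l i).comp (Pi.evalAddMonoidHom _ i)) m, fun c d => ?_⟩
  simp [l, m]

theorem tableWeight_basisWords : basisWords.map tableWeight =
    [(![1, 0, 0, 0, 0, 0], 0), (![0, 1, 0, 0, 0, 0], 0), (![0, 0, 1, 0, 0, 0], 0),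
     (![0, 0, 0, 1, 0, 0], 0), (![0, 0, 0, 0, 1, 0], 2), (![0, 0, 0, 0, 0, 1], 2),
     (![0, 0, 0, 0, 0, 0], 1)] := by
  have hl : ∀ b ∈ basisWords, b.length ≤ 15 := by decide
  rw [List.map_congr_left fun b hb => tableWeight_eq_decode (hl b hb)]
  decide +kernel

theorem exists_hom_basisWords {H : Type*} [AddCommGroup H] {ψ : List ℕ → H} (h : IsWeight ψ) :
    ∃ f : Target →+ H, ∀ b ∈ basisWords, f (tableWeight b) = ψ b := by
  have tors : ∀ b ∈ basisWords, b.length = 10 → 2 • ψ b = 0 := fun b hb hl => by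
    simpa using h.two_pow_smul 1 (basisWords_isGauss b hb) (by omega)
  have tors₇ : 4 • ψ [0, 1, 2, 3, 2, 0, 3, 1] = 0 :=
    h.two_pow_smul 2 (basisWords_isGauss _ (by simp [basisWords])) (by simp)
  have key := tableWeight_basisWords
  simp only [basisWords, List.map_cons, List.map_nil, List.cons.injEq, and_true,
    List.forall_mem_cons] at key tors ⊢
  obtain ⟨t₁, t₂, t₃, t₄, t₅, t₆, -⟩ := tors
  replace t₁ := t₁ rfl
  replace t₂ := t₂ rfl
  replace t₃ := t₃ rfl
  replace t₄ := t₄ rfl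
  replace t₅ := t₅ rfl
  replace t₆ := t₆ rfl
  -- From here on the words matter only through their table values and torsion, so they are made
  -- opaque.
  generalize [0, 1, 2, 3, 4, 3, 1, 4, 2, 0] = b₁ at *
  generalize [0, 1, 2, 3, 4, 0, 2, 4, 1, 3] = b₂ at *
  generalize [0, 1, 2, 3, 1, 4, 0, 2, 4, 3] = b₃ at *
  generalize [0, 1, 2, 1, 3, 4, 0, 4, 2, 3] = b₄ at *
  generalize [0, 1, 2, 3, 4, 2, 4, 0, 3, 1] = b₅ at *
  generalize [0, 1, 2, 3, 4, 3, 1, 4, 0, 2] = b₆ at *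
  generalize [0, 1, 2, 3, 2, 0, 3, 1] = b₇ at *
  obtain ⟨k₁, k₂, k₃, k₄, k₅, k₆, k₇⟩ := key
  -- The fifth and sixth basis words have a unit vector plus 2 in the last entry as table value. The
  -- images of these unit vectors are therefore corrected by `2 • ψ b₇`, and they stay 2-torsion
  -- because `4 • ψ b₇ = 0`.
  have hsub : ∀ m : H, 2 • m = 0 → 2 • (m - 2 • ψ b₇) = 0 := fun m hm => by
    rw [smul_sub, hm, smul_smul, zero_sub, neg_eq_zero]
    exact tors₇
  obtain ⟨f, hf⟩ := exists_addMonoidHom_target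
    ![ψ b₁, ψ b₂, ψ b₃, ψ b₄, ψ b₅ - 2 • ψ b₇, ψ b₆ - 2 • ψ b₇] (ψ b₇) (by
      intro i
      fin_cases i
      exacts [t₁, t₂, t₃, t₄, hsub _ t₅, hsub _ t₆]) tors₇
  have hc : ∀ (c : Fin 6 → ℤ) (d : ℤ) (t : Target),
      (fun i => (c i : ZMod 2), (d : ZMod 4)) = t → f t = ∑ i, c i • ![ψ b₁, ψ b₂, ψ b₃, ψ b₄,
        ψ b₅ - 2 • ψ b₇, ψ b₆ - 2 • ψ b₇] i + d • ψ b₇ := by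
    rintro c d _ rfl
    exact hf c d
  refine ⟨f, ?_, ?_, ?_, ?_, ?_, ?_, ?_, by simp⟩
  · rw [k₁, hc ![1, 0, 0, 0, 0, 0] 0 _ (by decide)]
    simp [Fin.sum_univ_six]
  · rw [k₂, hc ![0, 1, 0, 0, 0, 0] 0 _ (by decide)]
    simp [Fin.sum_univ_six]
  · rw [k₃, hc ![0, 0, 1, 0, 0, 0] 0 _ (by decide)]
    simp [Fin.sum_univ_six]
  · rw [k₄, hc ![0, 0, 0, 1, 0, 0] 0 _ (by decide)]
    simp [Fin.sum_univ_six]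
  · rw [k₅, hc ![0, 0, 0, 0, 1, 0] 2 _ (by decide)]
    simp [Fin.sum_univ_six, ← natCast_zsmul]
  · rw [k₆, hc ![0, 0, 0, 0, 0, 1] 2 _ (by decide)]
    simp [Fin.sum_univ_six, ← natCast_zsmul]
  · rw [k₇, hc ![0, 0, 0, 0, 0, 0] 1 _ (by decide)]
    simp [Fin.sum_univ_six]

/-- The invariant given by the table. -/
noncomputable def gammaHom : ZP →+ Target := isWeight_tableWeight.invariant

open Classical in
-- This is an exchange of summations, over subsets of letters and over entries of the table.
theorem gammaHom_cls (p : GaussWord) : gammaHom (cls p) = gammaBar5 p := by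
  rw [gammaHom, IsWeight.invariant_cls, subwordSum, gammaBar5]
  simp only [tableWeight]
  have hs : ∀ l : List (List ℕ × Target), ∑ S ∈ p.1.toFinset.powerset,
      (l.map fun e => if WordIso e.1 (keep S p.1) then e.2 else 0).sum
      = (l.map fun e => bracket e.1 p • e.2).sum := by
    intro l
    induction l with
    | nil => simp
    | cons e l ih =>
      simp only [List.map_cons, List.sum_cons, Finset.sum_add_distrib, ih]
      congr 1
      rw [← Finset.sum_filter, Finset.sum_const, bracket]
      rfl
  exact hs wordVectors

theorem gammaHom_emptyWord : gammaHom (cls emptyWord) = 0 := by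
  refine (isWeight_tableWeight.invariant_cls emptyWord).trans ?_
  simp [subwordSum, emptyWord, isWeight_tableWeight.nil]

/-- The degree is not smaller because the symbol at a basis word of rank 5 is its table value, which
is nonzero. -/
theorem gammaHom_hasDegree : HasDegree gammaHom 5 := by
  refine ⟨isWeight_tableWeight.hasDegreeLE, fun m hm => ?_⟩
  by_contra hlt
  have hb : [0, 1, 2, 3, 4, 3, 1, 4, 2, 0] ∈ basisWords := by simp [basisWords]
  let w : GaussWord := ⟨_, basisWords_isGauss _ hb⟩
  have h₁ := hm w w.letters subset_rfl (lt_of_lt_of_eq (not_le.1 hlt) (by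
    change 5 = [0, 1, 2, 3, 4, 3, 1, 4, 2, 0].toFinset.card
    decide))
  have h₂ : gammaHom (semiWord w w.letters) = tableWeight w.1 :=
    isWeight_tableWeight.invariant_semiWord_letters w
  have h₃ := (List.cons.inj tableWeight_basisWords).1
  rw [h₁] at h₂
  exact absurd (h₂.trans h₃) (by decide)

theorem exists_eq_comp_gammaHom {H : Type*} [AddCommGroup H] {v : ZP →+ H}
    (hv : HasDegreeLE v 5) (h0 : v (cls emptyWord) = 0) : ∃ f : Target →+ H, v = f.comp gammaHom := by
  obtain ⟨f, hf⟩ := exists_hom_basisWords (isWeight_symbol hv h0)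
  refine ⟨f, sub_eq_zero.1 (eq_zero_of_symbol_basisWords ?_ ?_ fun b hb => ?_)⟩
  · intro w S hS hc
    have : gammaHom (semiWord w S) = 0 := isWeight_tableWeight.hasDegreeLE w S hS hc
    simp [hv w S hS hc, this]
  · simp [h0, gammaHom_emptyWord]
  · have e : gammaHom (semiWord ⟨b, basisWords_isGauss b hb⟩ _) = tableWeight b :=
      isWeight_tableWeight.invariant_semiWord_letters ⟨b, basisWords_isGauss b hb⟩
    rw [symbol_eq ⟨b, basisWords_isGauss b hb⟩, AddMonoidHom.sub_apply, AddMonoidHom.comp_apply, e,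
      hf b hb, symbol_eq ⟨b, basisWords_isGauss b hb⟩, sub_self]

/-! ### Constants and the augmentation -/

theorem augmentation_cls (p : GaussWord) : augmentation (cls p) = 1 :=
  FreeAbelianGroup.lift_apply_of _ _

theorem augmentation_semiWord (w : GaussWord) {S : Finset ℕ} (hS : S.Nonempty) :
    augmentation (semiWord w S) = 0 := by
  rw [semiWord, map_sum]
  simp only [map_zsmul, augmentation_cls, smul_eq_mul, mul_one]
  exact Finset.sum_powerset_neg_one_pow_card_of_nonempty hS

theorem gammaHom_isReducedUniversal : IsReducedUniversal.{0, u} gammaHom 5 :=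
  ⟨gammaHom_hasDegree, gammaHom_emptyWord, fun _ _ _ hv h0 => exists_eq_comp_gammaHom hv h0⟩

theorem augmentation_prod_gammaHom_isUniversal :
    IsUniversal.{0, u} (augmentation.prod gammaHom) 5 := by
  refine ⟨⟨fun w S hS hc => ?_, fun m hm => gammaHom_hasDegree.2 fun w S hS hc => ?_⟩,
    fun H _ v hv => ?_⟩
  · exact Prod.ext (augmentation_semiWord w (Finset.card_pos.1 (by omega)))
      (gammaHom_hasDegree.1 w S hS hc)
  · exact congrArg Prod.snd (hm w S hS hc)
  -- Subtracting the constant invariant with value `v (cls emptyWord)` gives a normalized invariant,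
  -- to which reduced universality applies.
  · let a : ℤ →+ H := zmultiplesHom H (v (cls emptyWord))
    obtain ⟨f, hf⟩ := exists_eq_comp_gammaHom (v := v - a.comp augmentation) (fun w S hS hc => by
      simp [hv w S hS hc, augmentation_semiWord w (Finset.card_pos.1 (Nat.zero_lt_of_lt hc))])
      (by simp [a, augmentation_cls])
    refine ⟨a.coprod f, ?_⟩
    rw [sub_eq_iff_eq_add] at hf
    rw [hf]
    ext p
    simp [add_comm]

end GaussWords

theorem mainTheorem4 :
    ∃ Γ : GaussWords.ZP →+ GaussWords.Target,
      (∀ p : GaussWords.GaussWord, Γ (GaussWords.cls p) = GaussWords.gammaBar5 p) ∧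
      GaussWords.IsReducedUniversal.{0, u} Γ 5 ∧
      GaussWords.IsUniversal.{0, u} (GaussWords.augmentation.prod Γ) 5 :=
  ⟨GaussWords.gammaHom, GaussWords.gammaHom_cls, GaussWords.gammaHom_isReducedUniversal,
    GaussWords.augmentation_prod_gammaHom_isUniversal⟩
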